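/- **Problem.** An instance of $1||\sum T_i$ consists of $n$ jobs with processing times $p_j\in\mathbb N$ and due dates $d_j\in\mathbb N$. A sequence of all jobs is processed on one machine without interruption from time $0$; job $j$ completes at time $C_j$ and has tardiness $T_j=\max\{C_j-d_j,0\}$. The problem is to find a sequence that minimizes $\sum_j T_j$. **Branching.** For a set $S$ of $m\ge 1$ jobs to be processed from time $t$, let $[1],\dots,[m]$ be its jobs in EDD order (nondecreasing $d$, ties by nondecreasing $p$), and let $\ell=[\kappa]$ be its longest job (ties by smallest due date). Position $i$ is *eligible* if $\kappa\le i\le m$; putting $\ell$ in position $i$ leaves the subproblem $B(i)=\{[1],\dots,[i]\}\setminus\{\ell\}$ from time $t$ before $\ell$, and the subproblem $A(i)=\{[i+1],\dots,[m]\}$ from time $C(i)=t+\sum_{r\le i}p_{[r]}$ after $\ell$. Position $i$ is *eliminated* if $i<m$ and $C(i)\ge d_{[i+1]}$, or if $C(i)<d_{[r]}+p_{[r]}$ for some $r\in\{\kappa+1,\dots,i\}$. Algorithm TTBR1 solves $(S,t)$ by solving $B(i)$ and $A(i)$ recursively for every eligible $i$ and returning the best sequence obtained. **Algorithm TTBM-L**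 with parameter $k\ge 2$. A node consists of a start time $t$, a fixed sequence $\pi$ started at $t$, a set $S=\{[1],\dots,[m]\}$ of jobs to be scheduled after $\pi$, and a list $L$, which is empty or contains replacements for the first $k-1$ children of the node. The first $k$ children are as follows. If $L$ is empty or $j=k$, the $j$-th child exists if $j$ is an eligible position of the longest job $\ell$ of $S$, and it has the fixed sequence $\pi\,\beta\,\ell$, where $\beta$ is the TTBR1 solution of $B(j)$ (started when $\pi$ ends); otherwise it is the $j$-th entry of $L$, which may be missing. In each case the jobs $[j+1],\dots,[m]$ remain. The node is solved, that is, a best sequence found for the jobs of $\pi$ and $S$ is returned, as follows. * If $m<k$: the node, and each node of $L$, is completed by TTBR1 on its remaining jobs, and the best result is returned. * If $m\ge k$ and the first child $P_1$ exists (left merging): for $j=1,\dots,k-1$, the $(j+1)$-st child of the node is merged with the $j$-th child of $P_1$ obtained by branching (both fix the same jobs); the one whose fixed sequence has the smaller total tardiness from $t$ is kept, or the existing one if only one exists. Then $P_1$ is solved recursively with the list of the $k-1$ merged nodes. If $P_1$ does not exist, each existing child $2,\dots,k$ is solved recursively with an empty list. * If $m\ge k$, moreover, for every eligible, not eliminated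 position $i\in\{k+1,\dots,m\}$ of $\ell$ in $S$, the subproblems $B(i)$ and $A(i)$ are solved recursively (nothing fixed, empty list) and their solutions are combined with $\pi$ and $\ell$. The best of all sequences found is returned. TTBM-L starts from the node with $t=0$, $\pi$ empty, $S$ the set of all jobs and $L$ empty. Time is the number of elementary operations on a unit-cost random access machine (arithmetic and comparisons of numbers, reading input data, list operations), and space is the largest number of memory cells simultaneously in use. **Proposition.** For every $k\ge 2$, TTBM-L returns an optimal sequence on every instance. There are numbers $\varepsilon_k\ge 0$ with $\varepsilon_k\to 0$ as $k\to\infty$ such that, for every fixed $k\ge 2$, TTBM-L with parameter $k$ runs in $O^*\big((2.247+\varepsilon_k)^n\big)$ time and polynomial space: there is a polynomial $q_k$ such that on every instance with $n$ jobs the running time is at most $q_k(n)\,(2.247+\varepsilon_k)^n$ and the space is at most $q_k(n)$. -/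

import Mathlib

namespace TotalTardiness

/-! ### The problem -/

/-- An instance with `n` jobs: processing times and due dates. -/
structure Data (n : ℕ) where
  p : Fin n → ℕ
  d : Fin n → ℕ

variable {n : ℕ}

/-- Total tardiness of the jobs of a sequence that is processed without interruption from time `t`.
The first job `j` completes at `t + p j`; truncated subtraction is `max (C - d) 0`. -/
def Data.tardiness (I : Data n) : ℕ → List (Fin n) → ℕ
  | _, [] => 0
  | t, j :: σ => (t + I.p j - I.d j) + I.tardiness (t + I.p j) σ

/-- `σ` is a sequence of all the jobs, each exactly once. -/
def IsSequence (σ : List (Fin n)) : Prop := σ.Nodup ∧ ∀ j, j ∈ σ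

/-- `σ` is an optimal solution: a sequence of all jobs of least total tardiness from time `0`. -/
def Data.IsOptimal (I : Data n) (σ : List (Fin n)) : Prop :=
  IsSequence σ ∧ ∀ τ, IsSequence τ → I.tardiness 0 σ ≤ I.tardiness 0 τ

/-! ### The cost model

Unit-cost random access machine with region (stack) allocation. A memory cell holds a constant
number of words: numbers, job names, pointers. The instance is read-only input with random
access. Every elementary operation takes one unit of time and writes one fresh cell; this also pays
for the stack space of a loop or of an auxiliary recursion. Cells are released only when a
procedure call returns: then everything written during the call is released, except that the
returned list is copied, at unit time per cell, into the memory of the caller. -/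

/-- A computation with its result and its cost. -/
structure Comp (α : Type) where
  val : α
  /-- number of elementary steps -/
  time : ℕ
  /-- number of cells written and not released at the end -/
  kept : ℕ
  /-- largest number of cells that are simultaneously in use -/
  peak : ℕ

instance : Monad Comp where
  pure a := ⟨a, 0, 0, 0⟩
  bind m f :=
    ⟨(f m.val).val, m.time + (f m.val).time, m.kept + (f m.val).kept,
      max m.peak (m.kept + (f m.val).peak)⟩

/-- One elementary operation, with result `a`. -/
def step {α : Type} (a : α) : Comp α := ⟨a, 1, 1, 1⟩

/-- A procedure call that returns a list: one cell for the frame, memory of the callee on top of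
that of the caller, and at the end only the copy of the result survives. -/
def call {α : Type} (m : Comp (List α)) : Comp (List α) :=
  ⟨m.val, 1 + m.time + m.val.length, m.val.length, 1 + m.peak + m.val.length⟩

/-! Elementary operations on numbers, jobs and lists. -/

def add (a b : ℕ) : Comp ℕ := step (a + b)
def sub (a b : ℕ) : Comp ℕ := step (a - b)
def lt (a b : ℕ) : Comp Bool := step (decide (a < b))
def le (a b : ℕ) : Comp Bool := step (decide (a ≤ b))
def eqJob (i j : Fin n) : Comp Bool := step (decide (i = j))
def procTime (I : Data n) (j : Fin n) : Comp ℕ := step (I.p j)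
def dueDate (I : Data n) (j : Fin n) : Comp ℕ := step (I.d j)
def cons {α : Type} (a : α) (l : List α) : Comp (List α) := step (a :: l)

/-- `for i = a, a + 1, ..., a + m - 1`, updating `b`. -/
def forLoop {β : Type} (body : ℕ → β → Comp β) : (a m : ℕ) → β → Comp β
  | _, 0, b => step b
  | a, m + 1, b => do
    let b' ← body a b
    let a' ← add a 1
    forLoop body a' m b'

/-! ### List routines -/

def length {α : Type} : List α → Comp ℕ
  | [] => step 0
  | _ :: l => do
    let m ← length l
    add m 1

def append {α : Type} : List α → List α → Comp (List α)
  | [], l' => step l'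
  | a :: l, l' => do
    let r ← append l l'
    cons a r

/-- The first `i` entries and the remaining ones. -/
def split {α : Type} : ℕ → List α → Comp (List α × List α)
  | 0, l => step ([], l)
  | _ + 1, [] => step ([], [])
  | i + 1, a :: l => do
    let r ← split i l
    let l₁ ← cons a r.1
    step (l₁, r.2)

/-- Remove job `j` from a list in which it occurs once. -/
def remove (j : Fin n) : List (Fin n) → Comp (List (Fin n))
  | [] => step []
  | a :: l => do
    let b ← eqJob a j
    if b then step l else do
      let r ← remove j l
      cons a r

/-- `t` plus the total processing time of a list of jobs. -/
def endTime (I : Data n) : ℕ → List (Fin n) → Comp ℕ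
  | t, [] => step t
  | t, j :: l => do
    let q ← procTime I j
    let t' ← add t q
    endTime I t' l

/-- Computes the total tardiness of a sequence started at time `t`. -/
def evalSeq (I : Data n) : ℕ → List (Fin n) → Comp ℕ
  | _, [] => step 0
  | t, j :: l => do
    let q ← procTime I j
    let c ← add t q
    let e ← dueDate I j
    let late ← sub c e
    let r ← evalSeq I c l
    add late r

/-- The better of two sequences of the same jobs, both started at time `t`. -/
def best (I : Data n) (t : ℕ) (σ τ : List (Fin n)) : Comp (List (Fin n)) := do
  let a ← evalSeq I t σ
  let b ← evalSeq I t τ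
  let c ← le a b
  if c then step σ else step τ

/-! ### EDD order and the longest job -/

/-- `i` comes strictly before `j` in the order of due dates, ties broken by processing times. -/
def eddBefore (I : Data n) (i j : Fin n) : Comp Bool := do
  let a ← dueDate I i
  let b ← dueDate I j
  let c ← lt a b
  if c then step true else do
    let c' ← lt b a
    if c' then step false else do
      let q ← procTime I i
      let r ← procTime I j
      lt q r

def eddInsert (I : Data n) (j : Fin n) : List (Fin n) → Comp (List (Fin n))
  | [] => cons j []
  | a :: l => do
    let b ← eddBefore I a j
    if b then do
      let r ← eddInsert I j l
      cons a r
    else do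
      let r ← cons a l
      cons j r

/-- Sorts a list of jobs in EDD order (earliest due date first). -/
def eddSort (I : Data n) : List (Fin n) → Comp (List (Fin n))
  | [] => step []
  | j :: l => do
    let r ← eddSort I l
    eddInsert I j r

/-- Scan with current best job `b` in position `κ`; the head of the list has position `i`. -/
def longestAux (I : Data n) : Fin n → ℕ → ℕ → List (Fin n) → Comp (Fin n × ℕ)
  | b, κ, _, [] => step (b, κ)
  | b, κ, i, a :: l => do
    let q ← procTime I b
    let r ← procTime I a
    let c ← lt q r
    let i' ← add i 1
    if c then longestAux I a i i' l else longestAux I b κ i' l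

/-- The longest job of an EDD-sorted list `a :: l`, and its position, counted from `1`.
Ties are broken in favour of the earliest due date, which is the first one in the list. -/
def longest (I : Data n) (a : Fin n) (l : List (Fin n)) : Comp (Fin n × ℕ) :=
  longestAux I a 1 2 l

/-! ### Branching

All job sets are kept as EDD-sorted lists `S = [1], [2], ..., [m]`. Let `[κ]` be the longest job `ℓ`
of `S`. Branching puts `ℓ` in a position `i ≥ κ`; the set before `ℓ` is `[1], ..., [i]` without
`ℓ`, and the set after `ℓ` is `[i+1], ..., [m]`. -/

/-- TTBR1: branch on every eligible position of the longest job. The first argument bounds the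
depth of the recursion; it is always called with a bound of at least the number of jobs. -/
def ttbr1 (I : Data n) : ℕ → List (Fin n) → ℕ → Comp (List (Fin n))
  | 0, S, _ => step S
  | _ + 1, [], _ => step []
  | depth + 1, a :: l, t => do
    let (ℓ, κ) ← longest I a l
    let m ← length (a :: l)
    let m' ← add m 1
    let count ← sub m' κ
    forLoop (fun i seqOpt => do
      let (front, A) ← split i (a :: l)
      let B ← remove ℓ front
      let c ← endTime I t front
      let left ← call (ttbr1 I depth B t)
      let right ← call (ttbr1 I depth A c)
      let tail ← cons ℓ right
      let seqCurrent ← append left tail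
      best I t seqOpt seqCurrent) κ count (a :: l)

/-- Is `c < d r + p r` for some job `r` of the list? -/
def someLate (I : Data n) (c : ℕ) : List (Fin n) → Comp Bool
  | [] => step false
  | r :: l => do
    let e ← dueDate I r
    let q ← procTime I r
    let s ← add e q
    let b ← lt c s
    if b then step true else someLate I c l

/-- The elimination test for position `i` of the longest job `[κ]`, where `front` is
`[1], ..., [i]`, `A` is `[i+1], ..., [m]` and `c` is the completion time of the longest job:
(a) `i < m` and `c ≥ d [i+1]`, or (b) `c < d [r] + p [r]` for some `r = κ+1, ..., i`. -/
def eliminated (I : Data n) (κ c : ℕ) (front A : List (Fin n)) : Comp Bool := do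
  let (_, mid) ← split κ front
  let late ← someLate I c mid
  match A with
  | [] => step late
  | a :: _ => do
    let e ← dueDate I a
    let b ← le e c
    if b then step true else step late

/-! ### Left merging

A node consists of a sequence `π` of fixed jobs, started at time `t`, and of the EDD-sorted list
`S` of jobs that remain to be scheduled after `π`. Its `j`-th child for `j ≤ k` fixes the jobs
`[1], ..., [j]` of `S` as well; so it is given by a sequence of the jobs of `π` and
`[1], ..., [j]`, and the remaining list is `S` without its first `j` entries. It is `none` if
the child does not exist. A node also carries the list of its first `k - 1` children if they
result from a merging; otherwise this list is empty. -/

/-- The `j`-th child of the node `(π, S)` by branching, the small subproblem before the longest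
job being solved by TTBR1; `none` if position `j` is not eligible. -/
def child (I : Data n) (k t : ℕ) (π S : List (Fin n)) (j : ℕ) :
    Comp (Option (List (Fin n))) :=
  match S with
  | [] => step none
  | a :: l => do
    let (ℓ, κ) ← longest I a l
    let b ← le κ j
    if b then do
      let (front, _) ← split j (a :: l)
      let B ← remove ℓ front
      let t' ← endTime I t π
      let left ← call (ttbr1 I k B t')
      let tail ← cons ℓ []
      let mid ← append left tail
      let r ← append π mid
      step (some r)
    else step none

/-- The children `j, j + 1, ..., j + m - 1` of `(π, S)` by branching. -/
def childrenFrom (I : Data n) (k t : ℕ) (π S : List (Fin n)) :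
    (j m : ℕ) → Comp (List (Option (List (Fin n))))
  | _, 0 => step []
  | j, m + 1 => do
    let c ← child I k t π S j
    let j' ← add j 1
    let r ← childrenFrom I k t π S j' m
    cons c r

/-- The first `k` children of a node with list `L` by the improved branching. -/
def firstChildren (I : Data n) (k t : ℕ) (π S : List (Fin n))
    (L : List (Option (List (Fin n)))) : Comp (List (Option (List (Fin n)))) :=
  match L with
  | [] => childrenFrom I k t π S 1 k
  | _ :: _ => do
    let r ← childrenFrom I k t π S k 1
    append L r

/-- The better one of two nodes with the same fixed job set. -/
def bestNode (I : Data n) (t : ℕ) :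
    Option (List (Fin n)) → Option (List (Fin n)) → Comp (Option (List (Fin n)))
  | none, y => step y
  | some σ, none => step (some σ)
  | some σ, some τ => do
    let r ← best I t σ τ
    step (some r)

/-- Merges two lists of nodes entry by entry. -/
def mergeNodes (I : Data n) (t : ℕ) :
    List (Option (List (Fin n))) → List (Option (List (Fin n))) →
      Comp (List (Option (List (Fin n))))
  | x :: X, y :: Y => do
    let z ← bestNode I t x y
    let Z ← mergeNodes I t X Y
    cons z Z
  | _, _ => step []

/-- LEFT_MERGE: given the first child `(π₁, S₁)` of a node and the children `2, ..., k` of that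
node, the latter are merged with the children `1, ..., k - 1` of `(π₁, S₁)`; the result is the
list of the first `k - 1` children with which `(π₁, S₁)` will be explored. -/
def leftMerge (I : Data n) (k t : ℕ) (π₁ S₁ : List (Fin n))
    (others : List (Option (List (Fin n)))) : Comp (List (Option (List (Fin n)))) := do
  let k' ← sub k 1
  let own ← childrenFrom I k t π₁ S₁ 1 k'
  mergeNodes I t others own

/-- Explores each existing node of a list with the procedure `solve` and returns the best solution
found. The nodes of the list are the children `j, j + 1, ...` of a node with remaining jobs `S`. -/
def explore (I : Data n) (t : ℕ) (solve : List (Fin n) → List (Fin n) → Comp (List (Fin n)))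
    (S : List (Fin n)) :
    ℕ → List (Option (List (Fin n))) → List (Fin n) → Comp (List (Fin n))
  | _, [], seqOpt => step seqOpt
  | j, none :: L, seqOpt => do
    let j' ← add j 1
    explore I t solve S j' L seqOpt
  | j, some π :: L, seqOpt => do
    let (_, rest) ← split j S
    let seqCurrent ← call (solve π rest)
    let seqOpt' ← best I t seqOpt seqCurrent
    let j' ← add j 1
    explore I t solve S j' L seqOpt'

/-- Completes the sequence `π`, started at time `t`, by TTBR1 on a list `S` of fewer than `k` jobs. -/
def completeSmall (I : Data n) (k t : ℕ) (π S : List (Fin n)) : Comp (List (Fin n)) := do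
  let t' ← endTime I t π
  let σ ← call (ttbr1 I k S t')
  append π σ

/-- TTBM-L on the node with fixed sequence `π` started at time `t`, remaining EDD-sorted list `S` and
list `L` of merged children: the best sequence found for the jobs of `π` and `S` together.
The first numeric argument bounds the depth of the recursion; it always exceeds the number of jobs
in `S`. -/
def ttbmlNode (I : Data n) (k : ℕ) :
    ℕ → ℕ → List (Fin n) → List (Fin n) → List (Option (List (Fin n))) → Comp (List (Fin n))
  | 0, _, π, S, _ => append π S
  | depth + 1, t, π, S, L => do
    let m ← length S
    let small ← lt m k
    if small then do
      -- fewer than `k` jobs: TTBR1, on the node itself and on its merged children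
      let seqOpt ← completeSmall I k t π S
      explore I t (completeSmall I k t) S 1 L seqOpt
    else do
      let seqInit ← append π S
      let children ← firstChildren I k t π S L
      -- positions `1, ..., k`: merged into the first child if that exists
      let seqOpt ← match children with
        | some π₁ :: others => do
          let (_, S₁) ← split 1 S
          let L₁ ← leftMerge I k t π₁ S₁ others
          let seqCurrent ← call (ttbmlNode I k depth t π₁ S₁ L₁)
          best I t seqInit seqCurrent
        | others => explore I t (fun π' S' => ttbmlNode I k depth t π' S' []) S 1 others seqInit
      -- positions `k + 1, ..., m`: branching as in TTBR1, with elimination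
      match S with
      | [] => step seqOpt
      | a :: l => do
        let (ℓ, κ) ← longest I a l
        let t' ← endTime I t π
        let first ← add k 1
        let count ← sub m k
        forLoop (fun i seqOpt => do
          let eligible ← le κ i
          if eligible then do
            let (front, A) ← split i (a :: l)
            let c ← endTime I t' front
            let e ← eliminated I κ c front A
            if e then step seqOpt else do
              let B ← remove ℓ front
              let left ← call (ttbmlNode I k depth t' [] B [])
              let right ← call (ttbmlNode I k depth c [] A [])
              let tail ← cons ℓ right
              let mid ← append left tail
              let seqCurrent ← append π mid
              best I t seqOpt seqCurrent
          else step seqOpt) first count seqOpt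

/-- Algorithm TTBM-L with parameter `k`. -/
def ttbml (I : Data n) (k : ℕ) : Comp (List (Fin n)) := do
  let S ← eddSort I (List.finRange n)
  ttbmlNode I k (n + 1) 0 [] S []

end TotalTardiness

/-! Two exchange arguments show that some optimal sequence has the longest job at an eligible
position `i` that is not eliminated, preceded by the other jobs among the first `i` in EDD order and
followed by the rest. Hence a node is solved as soon as all these positions are tried. The first `k`
children of a node are solved by one recursive call with one job less: its list of merged children
dominates the children `2, ..., k`. Among two adjacent later positions at least one is eliminated,
so the subproblems before the longest job cost at most `x ^ (m - 1) + x ^ (m - 3) + ...`, and those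
after it only contribute `O(x ^ (m - k))`. The time is therefore polynomial times `x ^ n` when
`x⁻¹ + x / (x ^ 2 - 1) + 1 / (x ^ k * (x - 1)) ≤ 1`. Without the last term the smallest such `x` is
`2.2469...`, and `x = 2.247` satisfies the inequality already for `k = 20`. -/

namespace TotalTardiness

variable {n : ℕ}

/-! ### Exchange arguments -/

theorem perm_and_perm_of_append_perm {γ : Type*} {u v x y : List γ} (h : (u ++ v).Perm (x ++ y))
    (hnodup : (x ++ y).Nodup) (hv : ∀ j ∈ v, j ∈ y) (hu : ∀ j ∈ u, j ∉ y) :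
    u.Perm x ∧ v.Perm y := by
  have hvy : v.Perm y := by
    refine (List.perm_ext_iff_of_nodup (h.nodup_iff.2 hnodup).of_append_right
      hnodup.of_append_right).2 fun j => ⟨hv j, fun hj => ?_⟩
    have hjuv : j ∈ u ++ v := h.mem_iff.2 (by simp [hj])
    exact (List.mem_append.1 hjuv).resolve_left fun hju => hu j hju hj
  exact ⟨(List.perm_append_right_iff v).1 (h.trans (hvy.symm.append_left x)), hvy⟩

namespace Data

section Tardiness

variable (I : Data n)

/-- The total processing time of a list of jobs. -/
def load (l : List (Fin n)) : ℕ := (l.map I.p).sum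

@[simp] theorem load_nil : I.load [] = 0 := rfl

@[simp] theorem load_cons (j : Fin n) (l : List (Fin n)) : I.load (j :: l) = I.p j + I.load l := by
  simp [load]

@[simp] theorem load_append (l l' : List (Fin n)) : I.load (l ++ l') = I.load l + I.load l' := by
  simp [load]

variable {I} in
theorem load_eq_of_perm {l l' : List (Fin n)} (h : l.Perm l') : I.load l = I.load l' :=
  (h.map I.p).sum_eq

theorem tardiness_append (t : ℕ) (l l' : List (Fin n)) :
    I.tardiness t (l ++ l') = I.tardiness t l + I.tardiness (t + I.load l) l' := by
  induction l generalizing t with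
  | nil => simp [tardiness]
  | cons j l ih => simp [tardiness, ih, add_assoc]

theorem tardiness_mono {t t' : ℕ} (h : t ≤ t') (l : List (Fin n)) :
    I.tardiness t l ≤ I.tardiness t' l := by
  induction l generalizing t t' with
  | nil => exact le_rfl
  | cons j l ih =>
    have := ih (Nat.add_le_add_right h (I.p j))
    simp only [tardiness]
    omega

/-- Swapping two jobs delays the jobs between them by `I.p ℓ - I.p j` less, and the tardiness that
`ℓ` gains at its new place is at most what `j` loses there. -/
theorem tardiness_swap_le (t : ℕ) (u w z : List (Fin n)) {ℓ j : Fin n} (hp : I.p j ≤ I.p ℓ)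
    (hd : I.d j ≤ I.d ℓ ∨ I.d j ≤ t + I.load u + I.p ℓ) :
    I.tardiness t (u ++ j :: w ++ ℓ :: z) ≤ I.tardiness t (u ++ ℓ :: (w ++ j :: z)) := by
  have hw := I.tardiness_mono (Nat.add_le_add_left hp (t + I.load u)) w
  have hz : t + (I.load u + (I.p j + I.load w)) + I.p ℓ =
      t + I.load u + I.p ℓ + I.load w + I.p j := by omega
  simp only [tardiness_append, tardiness, load_append, load_cons, hz]
  omega

theorem tardiness_postpone_le (t : ℕ) (x y z : List (Fin n)) {ℓ r : Fin n} (hd : I.d ℓ ≤ I.d r)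
    (hr : t + I.load (x ++ r :: y) + I.p ℓ < I.d r + I.p r) :
    I.tardiness t (x ++ y ++ ℓ :: r :: z) ≤ I.tardiness t (x ++ r :: y ++ ℓ :: z) := by
  have hy := I.tardiness_mono (Nat.le_add_right (t + I.load x) (I.p r)) y
  have hz : t + (I.load x + I.load y) + I.p ℓ + I.p r =
      t + (I.load x + (I.p r + I.load y)) + I.p ℓ := by omega
  simp only [tardiness_append, tardiness, load_append, load_cons, hz] at hr ⊢
  omega

theorem exists_due_after_completion (t : ℕ) {ℓ : Fin n} (u v : List (Fin n))
    (hp : ∀ j ∈ v, I.p j ≤ I.p ℓ) :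
    ∃ u' v', (u' ++ ℓ :: v').Perm (u ++ ℓ :: v) ∧
      I.tardiness t (u' ++ ℓ :: v') ≤ I.tardiness t (u ++ ℓ :: v) ∧
      ∀ j ∈ v', I.d ℓ < I.d j ∧ t + I.load u' + I.p ℓ < I.d j := by
  induction hm : v.length using Nat.strong_induction_on generalizing u v with
  | _ m ih =>
    by_cases hdue : ∀ j ∈ v, I.d ℓ < I.d j ∧ t + I.load u + I.p ℓ < I.d j
    · exact ⟨u, v, .refl _, le_rfl, hdue⟩
    push Not at hdue
    obtain ⟨j, hj, hd⟩ := hdue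
    obtain ⟨w, z, rfl⟩ := List.append_of_mem hj
    have hswap := I.tardiness_swap_le t u w z (hp j hj) ((le_or_gt _ _).imp_right hd)
    have hperm : (u ++ j :: w ++ ℓ :: z).Perm (u ++ ℓ :: (w ++ j :: z)) := by
      simp only [List.perm_iff_count, List.count_append, List.count_cons]
      omega
    obtain ⟨u', v', hperm', hle, hdue⟩ := ih z.length (by simp at hm; omega) (u ++ j :: w) z
      (fun i hi => hp i (by simp [hi])) rfl
    exact ⟨u', v', hperm'.trans hperm, hle.trans hswap, hdue⟩

theorem exists_postponed (t : ℕ) {ℓ : Fin n} {Q : Fin n → Prop} (hQ : ∀ r, Q r → I.d ℓ ≤ I.d r)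
    (u v : List (Fin n)) (hv : ∀ j ∈ v, Q j ∧ t + I.load u + I.p ℓ < I.d j) :
    ∃ u' v', (u' ++ ℓ :: v').Perm (u ++ ℓ :: v) ∧
      I.tardiness t (u' ++ ℓ :: v') ≤ I.tardiness t (u ++ ℓ :: v) ∧
      (∀ j ∈ v', Q j ∧ t + I.load u' + I.p ℓ < I.d j) ∧
      ∀ r ∈ u', Q r → I.d r + I.p r ≤ t + I.load u' + I.p ℓ := by
  induction hm : u.length using Nat.strong_induction_on generalizing u v with
  | _ m ih =>
    by_cases hearly : ∀ r ∈ u, Q r → I.d r + I.p r ≤ t + I.load u + I.p ℓ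
    · exact ⟨u, v, .refl _, le_rfl, hv, hearly⟩
    push Not at hearly
    obtain ⟨r, hr, hQr, hd⟩ := hearly
    obtain ⟨x, y, rfl⟩ := List.append_of_mem hr
    have hpostpone := I.tardiness_postpone_le t x y v (hQ r hQr) hd
    have hperm : (x ++ y ++ ℓ :: r :: v).Perm (x ++ r :: y ++ ℓ :: v) := by
      simp only [List.perm_iff_count, List.count_append, List.count_cons]
      omega
    have hv' : ∀ j ∈ r :: v, Q j ∧ t + I.load (x ++ y) + I.p ℓ < I.d j := by
      simp only [List.mem_cons, forall_eq_or_imp, load_append, load_cons] at hv hd ⊢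
      exact ⟨⟨hQr, by omega⟩, fun j hj => ⟨(hv j hj).1, by have := (hv j hj).2; omega⟩⟩
    obtain ⟨u', v', hperm', hle, h⟩ := ih (x ++ y).length (by simp at hm ⊢; omega) (x ++ y)
      (r :: v) hv' rfl
    exact ⟨u', v', hperm'.trans hperm, hle.trans hpostpone, h⟩

end Tardiness

/-! ### The decomposition theorem -/

/-- The list of jobs is in EDD order (nondecreasing due dates). The order of jobs with the same
due date is left open. -/
def Edd (I : Data n) (S : List (Fin n)) : Prop := S.Pairwise fun i j => I.d i ≤ I.d j

/-- A set of jobs, represented by an EDD-ordered list without repetitions. -/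
structure IsEddSet (I : Data n) (S : List (Fin n)) : Prop where
  edd : I.Edd S
  nodup : S.Nodup

/-- Job `ℓ` is the first longest job of the list `S`, and `κ` is its position, counted from `1`. -/
def IsLongest (I : Data n) (S : List (Fin n)) (ℓ : Fin n) (κ : ℕ) : Prop :=
  ∃ u v, S = u ++ ℓ :: v ∧ κ = u.length + 1 ∧ (∀ j ∈ u, I.p j < I.p ℓ) ∧ ∀ j ∈ v, I.p j ≤ I.p ℓ

/-- Position `i` of the longest job `[κ]` of the EDD-ordered list `S` is eliminated when `S` is
started at time `t`. -/
def Eliminated (I : Data n) (t : ℕ) (S : List (Fin n)) (κ i : ℕ) : Prop :=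
  (∃ a ∈ (S.drop i).head?, I.d a ≤ t + I.load (S.take i)) ∨
    ∃ r ∈ (S.take i).drop κ, t + I.load (S.take i) < I.d r + I.p r

variable {I : Data n} {S π σ σ' ρ α β τ : List (Fin n)} {ℓ : Fin n} {κ i t : ℕ}

theorem Edd.exists_split_at_time (h : I.Edd S) (C : ℕ) :
    ∃ S₁ S₂, S = S₁ ++ S₂ ∧ (∀ j ∈ S₁, I.d j ≤ C) ∧ ∀ j ∈ S₂, C < I.d j := by
  induction S with
  | nil => exact ⟨[], [], by simp⟩
  | cons a S ih =>
    obtain ⟨ha, hS⟩ := List.pairwise_cons.1 h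
    by_cases hC : I.d a ≤ C
    · obtain ⟨S₁, S₂, rfl, h₁, h₂⟩ := ih hS
      exact ⟨a :: S₁, S₂, rfl, List.forall_mem_cons.2 ⟨hC, h₁⟩, h₂⟩
    · exact ⟨[], a :: S, rfl, by simp,
        List.forall_mem_cons.2 ⟨not_le.1 hC, fun j hj => (not_le.1 hC).trans_le (ha j hj)⟩⟩

theorem IsEddSet.sublist {S' : List (Fin n)} (h : I.IsEddSet S) (hS' : S'.Sublist S) :
    I.IsEddSet S' :=
  ⟨List.Pairwise.sublist hS' h.edd, h.nodup.sublist hS'⟩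

theorem IsEddSet.drop (h : I.IsEddSet S) (i : ℕ) : I.IsEddSet (S.drop i) :=
  h.sublist (List.drop_sublist _ _)

theorem IsEddSet.erase_take (h : I.IsEddSet S) (i : ℕ) (ℓ : Fin n) :
    I.IsEddSet ((S.take i).erase ℓ) :=
  h.sublist (List.erase_sublist.trans (List.take_sublist _ _))

namespace IsLongest

theorem pos (h : I.IsLongest S ℓ κ) : 0 < κ := by
  obtain ⟨u, v, -, rfl, -⟩ := h
  exact Nat.succ_pos _

theorem le_length (h : I.IsLongest S ℓ κ) : κ ≤ S.length := by
  obtain ⟨u, v, rfl, rfl, -⟩ := h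
  simp

theorem mem_take (h : I.IsLongest S ℓ κ) (hi : κ ≤ i) : ℓ ∈ S.take i := by
  obtain ⟨u, v, rfl, rfl, -⟩ := h
  obtain ⟨m, rfl⟩ := Nat.exists_eq_add_of_le hi
  simp [List.take_append, add_assoc, Nat.add_comm 1 m]

theorem length_erase_take (h : I.IsLongest S ℓ κ) (hi : κ ≤ i) (hiS : i ≤ S.length) :
    ((S.take i).erase ℓ).length = i - 1 := by
  rw [List.length_erase_of_mem (h.mem_take hi), List.length_take_of_le hiS]

theorem unique {ℓ' : Fin n} {κ' : ℕ} (h : I.IsLongest S ℓ κ) (h' : I.IsLongest S ℓ' κ') :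
    ℓ = ℓ' ∧ κ = κ' := by
  obtain ⟨u, v, rfl, rfl, hu, hv⟩ := h
  obtain ⟨u', v', heq, rfl, hu', hv'⟩ := h'
  rcases List.append_eq_append_iff.1 heq with ⟨w, rfl, hw⟩ | ⟨w, rfl, hw⟩ <;>
    rcases w with _ | ⟨j, w⟩
  · simp_all
  · grind
  · simp_all
  · grind

theorem perm_take (h : I.IsLongest S ℓ κ) (hi : κ ≤ i) (hβ : β.Perm ((S.take i).erase ℓ)) :
    (β ++ [ℓ]).Perm (S.take i) :=
  (List.perm_append_singleton ℓ β).trans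
    ((hβ.cons ℓ).trans (List.perm_cons_erase (h.mem_take hi)).symm)

theorem perm_append_cons (h : I.IsLongest S ℓ κ) (hi : κ ≤ i) (hβ : β.Perm ((S.take i).erase ℓ))
    (hα : α.Perm (S.drop i)) : (β ++ ℓ :: α).Perm S := by
  simpa using (h.perm_take hi hβ).append hα

theorem load_append_singleton (h : I.IsLongest S ℓ κ) (hi : κ ≤ i)
    (hβ : β.Perm ((S.take i).erase ℓ)) : I.load (β ++ [ℓ]) = I.load (S.take i) :=
  load_eq_of_perm (h.perm_take hi hβ)

end IsLongest

/-- After both exchanges, the jobs behind `ℓ` are exactly those behind it in EDD order that are due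
after its completion. -/
theorem exists_dominating_split {A B : List (Fin n)} (hS : I.IsEddSet (A ++ ℓ :: B))
    (hA : ∀ j ∈ A, I.p j ≤ I.p ℓ) (hB : ∀ j ∈ B, I.p j ≤ I.p ℓ) (t : ℕ)
    (hτ : τ.Perm (A ++ ℓ :: B)) :
    ∃ u v, (u ++ ℓ :: v).Perm (A ++ ℓ :: B) ∧ I.tardiness t (u ++ ℓ :: v) ≤ I.tardiness t τ ∧
      (∀ j ∈ v, j ∈ B ∧ t + I.load u + I.p ℓ < I.d j) ∧
      ∀ r ∈ u, r ∈ B → I.d r + I.p r ≤ t + I.load u + I.p ℓ := by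
  obtain ⟨-, hsorted, hAB⟩ := List.pairwise_append.1 hS.edd
  have hBdue : ∀ r ∈ B, I.d ℓ ≤ I.d r := (List.pairwise_cons.1 hsorted).1
  obtain ⟨u, v, rfl⟩ := List.append_of_mem (hτ.mem_iff.2 (by simp : ℓ ∈ A ++ ℓ :: B))
  have hp : ∀ j ∈ v, I.p j ≤ I.p ℓ := fun j hj => by
    have hjS : j ∈ A ++ ℓ :: B := hτ.subset (by simp [hj])
    grind
  obtain ⟨u₁, v₁, hperm₁, hle₁, hdue₁⟩ := I.exists_due_after_completion t u v hp
  have hv₁ : ∀ j ∈ v₁, j ∈ B ∧ t + I.load u₁ + I.p ℓ < I.d j := fun j hj => by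
    have hjS : j ∈ A ++ ℓ :: B := (hperm₁.trans hτ).subset (by simp [hj])
    have hjA : j ∉ A := fun h => (hdue₁ j hj).1.not_ge (hAB j h ℓ (by simp))
    have hjℓ : j ≠ ℓ := fun h => (hdue₁ j hj).1.ne' (congrArg I.d h)
    exact ⟨by simpa [hjA, hjℓ] using hjS, (hdue₁ j hj).2⟩
  obtain ⟨u₂, v₂, hperm₂, hle₂, h₂⟩ := I.exists_postponed t hBdue u₁ v₁ hv₁
  exact ⟨u₂, v₂, hperm₂.trans (hperm₁.trans hτ), hle₂.trans hle₁, h₂⟩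

theorem IsLongest.exists_decomposition (h : I.IsLongest S ℓ κ) (hS : I.IsEddSet S) (t : ℕ)
    (hτ : τ.Perm S) :
    ∃ i β α, κ ≤ i ∧ i ≤ S.length ∧ ¬ I.Eliminated t S κ i ∧
      β.Perm ((S.take i).erase ℓ) ∧ α.Perm (S.drop i) ∧
      I.tardiness t (β ++ ℓ :: α) ≤ I.tardiness t τ := by
  obtain ⟨A, B, rfl, rfl, hA, hB⟩ := h
  obtain ⟨u, v, hperm, hle, hv, hu⟩ :=
    exists_dominating_split hS (fun j hj => (hA j hj).le) hB t hτ
  obtain ⟨B₁, B₂, rfl, hB₁, hB₂⟩ :=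
    Edd.exists_split_at_time (hS.sublist (S' := B) (by simp)).edd (t + I.load u + I.p ℓ)
  have hS_eq : A ++ ℓ :: (B₁ ++ B₂) = (A ++ ℓ :: B₁) ++ B₂ := by simp
  rw [hS_eq] at hS hperm ⊢
  have hv₂ : ∀ j ∈ v, j ∈ B₂ := fun j hj =>
    (List.mem_append.1 (hv j hj).1).resolve_left fun hj₁ => (hB₁ j hj₁).not_gt (hv j hj).2
  have hu₂ : ∀ j ∈ u ++ [ℓ], j ∉ B₂ := by
    simp only [List.mem_append, List.mem_singleton]
    rintro j (hj | rfl) hj₂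
    · have := hu j hj (by simp [hj₂])
      have := hB₂ j hj₂
      omega
    · exact List.disjoint_of_nodup_append hS.nodup (by simp) hj₂
  obtain ⟨hfront, hback⟩ := perm_and_perm_of_append_perm (u := u ++ [ℓ]) (by simpa using hperm)
    hS.nodup hv₂ hu₂
  have herase : (A ++ ℓ :: B₁).erase ℓ = A ++ B₁ := by
    rw [List.erase_append_right _ fun hℓA => (hA ℓ hℓA).false, List.erase_cons_head]
  have hu₁ : u.Perm (A ++ B₁) :=
    herase ▸ (List.cons_perm_iff_perm_erase.1
      ((List.perm_append_singleton ℓ u).symm.trans hfront)).2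
  have hload : I.load (A ++ ℓ :: B₁) = I.load u + I.p ℓ := by
    simpa using (load_eq_of_perm (I := I) hfront).symm
  refine ⟨(A ++ ℓ :: B₁).length, u, v, by simp, by simp, ?_, ?_, ?_, hle⟩
  · have hmid : (A ++ ℓ :: B₁).drop (A.length + 1) = B₁ := by simp [List.drop_append]
    rw [Eliminated, List.take_left, List.drop_left, hload, hmid, ← add_assoc]
    rintro (⟨a, ha, hda⟩ | ⟨r, hr, hdr⟩)
    · exact (hB₂ a (List.mem_of_mem_head? ha)).not_ge hda
    · exact (hu r (hu₁.mem_iff.2 (by simp [hr])) (by simp [hr])).not_gt hdr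
  · rwa [List.take_left, herase]
  · rwa [List.drop_left]

theorem eliminated_or_eliminated_succ (I : Data n) (t : ℕ) (S : List (Fin n))
    (hκ : κ ≤ i) (hi : i < S.length) : I.Eliminated t S κ i ∨ I.Eliminated t S κ (i + 1) := by
  have htake : S.take (i + 1) = S.take i ++ [S[i]] := by simp
  rcases le_or_gt (I.d S[i]) (t + I.load (S.take i)) with hd | hd
  · exact .inl (.inl ⟨S[i], by simp [List.head?_drop, hi], hd⟩)
  · refine .inr (.inr ⟨S[i], ?_, ?_⟩)
    · rw [htake, List.drop_append_of_le_length (by simp; omega)]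
      simp
    · rw [htake, load_append, load_cons, load_nil]
      omega

/-- From time `t`, the sequence `σ` is at least as good as every completion of `ρ` by the
jobs `R`. -/
def Dominates (I : Data n) (t : ℕ) (σ ρ R : List (Fin n)) : Prop :=
  ∀ τ, τ.Perm R → I.tardiness t σ ≤ I.tardiness t (ρ ++ τ)

/-- The sequence `σ` is an optimal solution of the subproblem of scheduling `S` from time `t`. -/
structure Solves (I : Data n) (t : ℕ) (S σ : List (Fin n)) : Prop where
  perm : σ.Perm S
  le : ∀ τ, τ.Perm S → I.tardiness t σ ≤ I.tardiness t τ

/-- From time `t`, the sequence `σ` is at least as good as every sequence that consists of `π` and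
the jobs `S` and that has `ℓ` in position `i` among the latter, after the other first `i` jobs. -/
def DominatesPosition (I : Data n) (t : ℕ) (σ π S : List (Fin n)) (ℓ : Fin n) (i : ℕ) : Prop :=
  ∀ β α, β.Perm ((S.take i).erase ℓ) → α.Perm (S.drop i) →
    I.tardiness t σ ≤ I.tardiness t (π ++ (β ++ ℓ :: α))

theorem Dominates.of_le {R : List (Fin n)} (h : I.Dominates t σ ρ R)
    (hle : I.tardiness t σ' ≤ I.tardiness t σ) : I.Dominates t σ' ρ R :=
  fun τ hτ => hle.trans (h τ hτ)

theorem Dominates.of_perm_of_le {R : List (Fin n)} (h : I.Dominates t σ ρ R) (hperm : ρ.Perm π)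
    (hle : I.tardiness t ρ ≤ I.tardiness t π) : I.Dominates t σ π R := by
  refine fun τ hτ => (h τ hτ).trans ?_
  rw [tardiness_append, tardiness_append, load_eq_of_perm hperm]
  exact Nat.add_le_add_right hle _

theorem DominatesPosition.of_le (h : I.DominatesPosition t σ π S ℓ i)
    (hle : I.tardiness t σ' ≤ I.tardiness t σ) : I.DominatesPosition t σ' π S ℓ i :=
  fun β α hβ hα => hle.trans (h β α hβ hα)

theorem IsLongest.dominates (h : I.IsLongest S ℓ κ) (hS : I.IsEddSet S)
    (hσ : ∀ i, κ ≤ i → i ≤ S.length → ¬ I.Eliminated (t + I.load π) S κ i →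
      I.DominatesPosition t σ π S ℓ i) : I.Dominates t σ π S := by
  intro τ hτ
  obtain ⟨i, β, α, hκ, hi, helim, hβ, hα, hle⟩ := h.exists_decomposition hS (t + I.load π) hτ
  refine (hσ i hκ hi helim β α hβ hα).trans ?_
  simpa only [tardiness_append _ _ π] using Nat.add_le_add_left hle _

theorem IsLongest.tardiness_append_cons (h : I.IsLongest S ℓ κ) (hi : κ ≤ i)
    (hβ : β.Perm ((S.take i).erase ℓ)) (t : ℕ) (α : List (Fin n)) :
    I.tardiness t (β ++ ℓ :: α) = I.tardiness t β +
      ((t + I.load (S.take i) - I.d ℓ) + I.tardiness (t + I.load (S.take i)) α) := by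
  rw [← h.load_append_singleton hi hβ]
  simp only [tardiness_append, tardiness, load_append, load_cons, load_nil, add_zero, add_assoc]

theorem IsLongest.dominatesPosition_of_solves (h : I.IsLongest S ℓ κ) (hi : κ ≤ i)
    (hβ : I.Solves (t + I.load π) ((S.take i).erase ℓ) β)
    (hα : I.Solves (t + I.load π + I.load (S.take i)) (S.drop i) α) :
    I.DominatesPosition t (π ++ (β ++ ℓ :: α)) π S ℓ i := by
  intro β' α' hβ' hα'
  rw [tardiness_append _ _ π, tardiness_append _ _ π, h.tardiness_append_cons hi hβ.perm,
    h.tardiness_append_cons hi hβ']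
  gcongr
  exacts [hβ.le β' hβ', hα.le α' hα']

theorem IsLongest.dominatesPosition_of_dominates (h : I.IsLongest S ℓ κ) (hi : κ ≤ i)
    (hperm : ρ.Perm (π ++ S.take i))
    (hle : ∀ β, β.Perm ((S.take i).erase ℓ) → I.tardiness t ρ ≤ I.tardiness t (π ++ (β ++ [ℓ])))
    (hσ : I.Dominates t σ ρ (S.drop i)) : I.DominatesPosition t σ π S ℓ i := by
  intro β α hβ hα
  have hρ : ρ.Perm (π ++ (β ++ [ℓ])) := hperm.trans ((h.perm_take hi hβ).symm.append_left π)
  simpa using hσ.of_perm_of_le hρ (hle β hβ) α hα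

end Data

/-! ### The recurrence -/

section Recurrence

variable {x : ℝ}

theorem sum_pow_le_of_not_adjacent (hx : 1 < x) (E : ℕ → Prop) [DecidablePred E] (m : ℕ)
    (hE : ∀ j, j + 1 < m → E j → ¬ E (j + 1)) :
    ∑ j ∈ Finset.range m with E j, x ^ j ≤ x ^ (m + 1) / (x ^ 2 - 1) := by
  have hpos : 0 < x ^ 2 - 1 := sub_pos.2 (one_lt_pow₀ hx two_ne_zero)
  induction m using Nat.twoStepInduction with
  | zero => simpa using div_nonneg (by linarith) hpos.le
  | one =>
    have : (1 : ℝ) ≤ x ^ 2 / (x ^ 2 - 1) := (one_le_div hpos).2 (by linarith)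
    rw [Finset.sum_filter, Finset.sum_range_one]
    split_ifs <;> simp <;> linarith
  | more m ih ih' =>
    rw [Finset.sum_filter, Finset.sum_range_succ, ← Finset.sum_filter]
    by_cases hm : E (m + 1)
    · have hm' : ¬ E m := fun h => hE m (by omega) h hm
      rw [if_pos hm, Finset.sum_filter, Finset.sum_range_succ, ← Finset.sum_filter, if_neg hm',
        add_zero]
      calc _ ≤ x ^ (m + 1) / (x ^ 2 - 1) + x ^ (m + 1) :=
            add_le_add_left (ih fun j hj => hE j (by omega)) _
        _ = x ^ (m + 2 + 1) / (x ^ 2 - 1) := by field_simp; ring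
    · rw [if_neg hm, add_zero]
      refine (ih' fun j hj => hE j (by omega)).trans ?_
      gcongr
      exacts [hx.le, by omega]

theorem sum_Ico_pow_sub_le (hx : 1 < x) (a : ℕ) {b m : ℕ} (hb : b ≤ m + 1) :
    ∑ j ∈ Finset.Ico a b, x ^ (m - j) ≤ x ^ (m + 1 - a) / (x - 1) := by
  have : 0 < x - 1 := sub_pos.2 hx
  calc ∑ j ∈ Finset.Ico a b, x ^ (m - j)
      = ∑ j ∈ Finset.Ico (m + 1 - b) (m + 1 - a), x ^ j := Finset.sum_Ico_reflect (x ^ ·) a hb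
    _ ≤ ∑ j ∈ Finset.range (m + 1 - a), x ^ j := by
      rw [Finset.range_eq_Ico]
      gcongr
      simp
    _ ≤ x ^ (m + 1 - a) / (x - 1) := by
      rw [geom_sum_eq hx.ne']
      gcongr
      simp

/-- The base `x` is large enough for the recurrence of TTBM-L with parameter `k`: the three
summands account for the first child, for the subproblems before the longest job, at most one of
which belongs to any two adjacent positions, and for those after it. -/
structure IsGrowthRate (k : ℕ) (x : ℝ) : Prop where
  two_le : 2 ≤ x
  le_one : x⁻¹ + x / (x ^ 2 - 1) + (x ^ k * (x - 1))⁻¹ ≤ 1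

namespace IsGrowthRate

variable {k m : ℕ}

theorem one_lt (h : IsGrowthRate k x) : 1 < x := one_lt_two.trans_le h.two_le

theorem pow_le (h : IsGrowthRate k x) (hk : 0 < k) (hm : k ≤ m) :
    x ^ (m - 1) + x ^ (m + 1) / (x ^ 2 - 1) + x ^ (m - k) / (x - 1) ≤ x ^ m := by
  have hx : 0 < x := by linarith [h.two_le]
  calc x ^ (m - 1) + x ^ (m + 1) / (x ^ 2 - 1) + x ^ (m - k) / (x - 1)
      = x ^ m * (x⁻¹ + x / (x ^ 2 - 1) + (x ^ k * (x - 1))⁻¹) := by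
        rw [pow_sub₀ x hx.ne' (hk.trans_le hm), pow_sub₀ x hx.ne' hm, mul_inv]
        ring
    _ ≤ x ^ m := mul_le_of_le_one_right (by positivity) h.le_one

theorem sum_le (h : IsGrowthRate k x) (hk : 0 < k) (hm : k ≤ m) (E : ℕ → Prop) [DecidablePred E]
    (hE : ∀ i, i < m → E i → ¬ E (i + 1)) :
    x ^ (m - 1) + ∑ i ∈ Finset.Ico (k + 1) (m + 1) with E i, (x ^ (i - 1) + x ^ (m - i)) ≤
      x ^ m := by
  have hx : 0 ≤ x := by linarith [h.two_le]
  have hbefore : ∑ i ∈ Finset.Ico (k + 1) (m + 1) with E i, x ^ (i - 1) ≤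
      x ^ (m + 1) / (x ^ 2 - 1) := by
    refine le_trans ?_ (sum_pow_le_of_not_adjacent h.one_lt (fun j => E (j + 1)) m
      fun j hj => hE (j + 1) hj)
    rw [Finset.sum_filter, Finset.sum_filter, ← Finset.sum_Ico_add' _ k m 1, Finset.range_eq_Ico]
    exact Finset.sum_le_sum_of_subset_of_nonneg (Finset.Ico_subset_Ico_left k.zero_le)
      fun j _ _ => by split_ifs <;> positivity
  have hafter : ∑ i ∈ Finset.Ico (k + 1) (m + 1) with E i, x ^ (m - i) ≤
      x ^ (m - k) / (x - 1) := by
    refine (Finset.sum_le_sum_of_subset_of_nonneg (Finset.filter_subset _ _)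
      fun i _ _ => by positivity).trans ?_
    simpa using sum_Ico_pow_sub_le h.one_lt (k + 1) (le_refl (m + 1))
  rw [Finset.sum_add_distrib]
  linarith [h.pow_le hk hm]

theorem mono {k' : ℕ} (h : IsGrowthRate k x) (hk : k ≤ k') : IsGrowthRate k' x := by
  have hpos : 0 < x - 1 := sub_pos.2 h.one_lt
  refine ⟨h.two_le, le_trans ?_ h.le_one⟩
  gcongr
  · exact mul_pos (pow_pos (zero_lt_one.trans h.one_lt) k) hpos
  · exact h.one_lt.le

end IsGrowthRate

theorem isGrowthRate_of_twenty_le {k : ℕ} (hk : 20 ≤ k) : IsGrowthRate k 2.247 :=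
  IsGrowthRate.mono ⟨by norm_num, by norm_num⟩ hk

theorem isGrowthRate_of_pos {k : ℕ} (hk : 0 < k) : IsGrowthRate k (2.247 + 1) :=
  IsGrowthRate.mono (k := 1) ⟨by norm_num, by norm_num⟩ hk

end Recurrence

/-! ### A logic for results and costs -/

section CostLogic

variable {α β : Type}

theorem Comp.bind_assoc {γ : Type} (m : Comp α) (f : α → Comp β) (g : β → Comp γ) :
    m >>= f >>= g = m >>= fun a => f a >>= g := by
  simp only [Bind.bind, Comp.mk.injEq, true_and]
  omega

/-- The result of `m` satisfies `Q`; its time is at most `W + X`, it keeps at most `W` cells, and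
its peak is at most `W + P`. Here `W` accounts for the work done by the procedure itself, while `X`
and `P` account for time and memory of recursive calls. -/
structure Spec (m : Comp α) (Q : α → Prop) (W : ℕ) (X : ℝ) (P : ℕ) : Prop where
  val : Q m.val
  time : (m.time : ℝ) ≤ W + X
  kept : m.kept ≤ W
  peak : m.peak ≤ W + P

namespace Spec

variable {m : Comp α} {f : α → Comp β} {Q Q' : α → Prop} {R : β → Prop} {W W' P P' : ℕ} {X X' : ℝ}

theorem mono (h : Spec m Q W X P) (hQ : ∀ a, Q a → Q' a) (hW : W ≤ W' := by omega)
    (hX : X ≤ X' := by linarith) (hP : P ≤ P' := by omega) : Spec m Q' W' X' P' := by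
  refine ⟨hQ _ h.val, h.time.trans ?_, h.kept.trans hW, h.peak.trans (by omega)⟩
  gcongr

theorem bind (h : Spec m Q W X P) (h' : ∀ a, Q a → Spec (f a) R (W' - W) (X' - X) P)
    (hW : W ≤ W' := by omega) : Spec (m >>= f) R W' X' P := by
  obtain ⟨hval, htime, hkept, hpeak⟩ := h' _ h.val
  refine ⟨hval, ?_, ?_, ?_⟩
  · have := h.time
    rw [Nat.cast_sub hW] at htime
    change ((m.time + (f m.val).time : ℕ) : ℝ) ≤ _
    push_cast
    linarith
  · have := h.kept
    change m.kept + (f m.val).kept ≤ _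
    omega
  · have := h.kept
    have := h.peak
    change max m.peak (m.kept + (f m.val).peak) ≤ _
    omega

theorem bind_local (h : Spec m Q W 0 0) (h' : ∀ a, Q a → Spec (f a) R (W' - W) X P)
    (hW : W ≤ W' := by omega) : Spec (m >>= f) R W' X P :=
  (h.mono fun _ => id).bind (W := W) (X := 0) (by simpa using h')

theorem bind_eq {a : α} (h : Spec m (· = a) W 0 0) (h' : Spec (f a) R (W' - W) X P)
    (hW : W ≤ W' := by omega) : Spec (m >>= f) R W' X P :=
  h.bind_local (by rintro _ rfl; exact h') hW

theorem of_step {a : α} (h : Q a) (hW : 1 ≤ W := by omega) (hX : 0 ≤ X := by linarith) :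
    Spec (step a) Q W X P := by
  refine ⟨h, ?_, hW, by simp only [step]; omega⟩
  have : (1 : ℝ) ≤ W := mod_cast hW
  simp only [step, Nat.cast_one]
  linarith

theorem step_bind {a : α} (h : Spec (f a) R (W - 1) X P) (hW : 1 ≤ W := by omega) :
    Spec (step a >>= f) R W X P :=
  (of_step rfl : Spec (step a) (· = a) 1 0 0).bind_eq h

theorem call_local {m : Comp (List α)} {Q : List α → Prop} {N : ℕ} (h : Spec m Q W 0 0)
    (hN : ∀ l, Q l → l.length ≤ N) : Spec (TotalTardiness.call m) Q (1 + W + N) 0 0 := by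
  obtain ⟨hval, htime, -, hpeak⟩ := h
  have hl := hN _ hval
  simp only [add_zero, Nat.cast_le] at htime
  refine ⟨hval, ?_, ?_, ?_⟩ <;> simp only [TotalTardiness.call, add_zero, Nat.cast_le] <;> omega

theorem call {m : Comp (List α)} {Q : List α → Prop} {N : ℕ} (h : Spec m Q W X P)
    (hN : ∀ l, Q l → l.length ≤ N) : Spec (TotalTardiness.call m) Q (1 + N) (W + X) (W + P) := by
  obtain ⟨hval, htime, -, hpeak⟩ := h
  have hl := hN _ hval
  have hl' : (m.val.length : ℝ) ≤ N := mod_cast hl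
  refine ⟨hval, ?_, ?_, ?_⟩ <;> simp only [TotalTardiness.call]
  · push_cast
    linarith
  all_goals omega

end Spec

theorem forLoop_spec {body : ℕ → β → Comp β} {Inv : ℕ → β → Prop} {W P : ℕ} {X : ℕ → ℝ} (m : ℕ) :
    ∀ (a : ℕ) (b : β), Inv a b →
      (∀ i b, a ≤ i → i < a + m → Inv i b → Spec (body i b) (Inv (i + 1)) W (X i) P) →
      Spec (forLoop body a m b) (Inv (a + m)) (m * (W + 1) + 1)
        (∑ i ∈ Finset.Ico a (a + m), X i) P := by
  induction m with
  | zero => exact fun a b hb _ => Spec.of_step hb (hX := by simp)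
  | succ m ih =>
    intro a b hb hbody
    have hsplit := Finset.sum_eq_sum_Ico_succ_bot (show a < a + (m + 1) by omega) X
    have hWm : (m + 1) * (W + 1) = m * (W + 1) + W + 1 := by ring
    refine (hbody a b le_rfl (by omega) hb).bind fun b' hb' => Spec.step_bind ?_
    rw [show a + (m + 1) = a + 1 + m by omega] at hsplit ⊢
    exact (ih (a + 1) b' hb' fun i b hi hi' => hbody i b (by omega) (by omega)).mono fun _ => id

/-! ### List routines -/

theorem length_spec (l : List α) : Spec (length l) (· = l.length) (l.length + 1) 0 0 := by
  induction l with
  | nil => exact Spec.of_step rfl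
  | cons a l ih =>
    rw [List.length_cons]
    exact ih.bind_eq (Spec.of_step rfl)

theorem append_spec (l l' : List α) : Spec (append l l') (· = l ++ l') (l.length + 1) 0 0 := by
  induction l with
  | nil => exact Spec.of_step rfl
  | cons a l ih =>
    rw [List.length_cons]
    exact ih.bind_eq (Spec.of_step rfl)

theorem split_spec (i : ℕ) (l : List α) :
    Spec (split i l) (· = (l.take i, l.drop i)) (2 * l.length + 1) 0 0 := by
  induction l generalizing i with
  | nil => cases i <;> exact Spec.of_step rfl
  | cons a l ih =>
    cases i with
    | zero => exact Spec.of_step rfl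
    | succ i =>
      rw [List.length_cons]
      exact (ih i).bind_eq (Spec.step_bind (Spec.of_step rfl))

end CostLogic

theorem remove_spec (j : Fin n) (l : List (Fin n)) :
    Spec (remove j l) (· = l.erase j) (2 * l.length + 1) 0 0 := by
  induction l with
  | nil => exact Spec.of_step rfl
  | cons a l ih =>
    rw [List.length_cons]
    refine Spec.step_bind ?_
    simp only [decide_eq_true_eq]
    split_ifs with hj
    · exact Spec.of_step (by simp [hj])
    · exact ih.bind_eq (Spec.of_step (by simp [hj]))

theorem endTime_spec (I : Data n) (t : ℕ) (l : List (Fin n)) :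
    Spec (endTime I t l) (· = t + I.load l) (2 * l.length + 1) 0 0 := by
  induction l generalizing t with
  | nil => exact Spec.of_step rfl
  | cons j l ih =>
    rw [List.length_cons, Data.load_cons, ← add_assoc]
    exact Spec.step_bind (Spec.step_bind ((ih _).mono fun _ => id))

theorem evalSeq_spec (I : Data n) (t : ℕ) (l : List (Fin n)) :
    Spec (evalSeq I t l) (· = I.tardiness t l) (5 * l.length + 1) 0 0 := by
  induction l generalizing t with
  | nil => exact Spec.of_step rfl
  | cons j l ih =>
    rw [List.length_cons]
    exact Spec.step_bind (Spec.step_bind (Spec.step_bind (Spec.step_bind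
      ((ih _).bind_eq (Spec.of_step rfl)))))

theorem best_spec (I : Data n) (t : ℕ) {σ τ J : List (Fin n)} (hσ : σ.Perm J) (hτ : τ.Perm J) :
    Spec (best I t σ τ) (fun r => r.Perm J ∧ I.tardiness t r ≤ I.tardiness t σ ∧
      I.tardiness t r ≤ I.tardiness t τ) (10 * J.length + 4) 0 0 := by
  have := hσ.length_eq
  have := hτ.length_eq
  refine (evalSeq_spec I t σ).bind_eq ((evalSeq_spec I t τ).bind_eq (Spec.step_bind ?_))
  simp only [decide_eq_true_eq]
  split_ifs with h
  · exact Spec.of_step ⟨hσ, le_rfl, h⟩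
  · exact Spec.of_step ⟨hτ, (not_le.1 h).le, le_rfl⟩

/-! ### Sorting, the longest job and the elimination test -/

section Jobs

variable (I : Data n)

theorem eddBefore_spec (i j : Fin n) :
    Spec (eddBefore I i j) (fun b => if b then I.d i ≤ I.d j else I.d j ≤ I.d i) 7 0 0 := by
  refine Spec.step_bind (Spec.step_bind (Spec.step_bind ?_))
  simp only [decide_eq_true_eq]
  split_ifs with hij
  · exact Spec.of_step hij.le
  refine Spec.step_bind ?_
  simp only [decide_eq_true_eq]
  split_ifs with hji
  · exact Spec.of_step hji.le
  · exact Spec.step_bind (Spec.step_bind (Spec.of_step (by split_ifs <;> omega)))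

theorem eddInsert_spec (j : Fin n) {l : List (Fin n)} (hl : I.Edd l) :
    Spec (eddInsert I j l) (fun r => r.Perm (j :: l) ∧ I.Edd r) (8 * l.length + 2) 0 0 := by
  induction l with
  | nil => exact Spec.of_step (by simp [Data.Edd])
  | cons a l ih =>
    obtain ⟨ha, hl'⟩ := List.pairwise_cons.1 hl
    rw [List.length_cons]
    refine (eddBefore_spec I a j).bind_local fun b hb => ?_
    split_ifs at hb ⊢
    · refine (ih hl').bind_local fun r hr => Spec.of_step ⟨(hr.1.cons a).trans (.swap _ _ _), ?_⟩
      refine List.pairwise_cons.2 ⟨fun i hi => ?_, hr.2⟩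
      rcases List.mem_cons.1 (hr.1.subset hi) with rfl | hi
      exacts [hb, ha i hi]
    · refine Spec.step_bind (Spec.of_step ⟨.refl _, List.pairwise_cons.2 ⟨?_, hl⟩⟩)
      exact List.forall_mem_cons.2 ⟨hb, fun i hi => hb.trans (ha i hi)⟩

theorem eddSort_spec (l : List (Fin n)) :
    Spec (eddSort I l) (fun r => r.Perm l ∧ I.Edd r) (l.length * (8 * l.length + 2) + 1) 0 0 := by
  induction l with
  | nil => exact Spec.of_step (by simp [Data.Edd])
  | cons j l ih =>
    have hcost : l.length * (8 * l.length + 2) + 1 + (8 * l.length + 2) ≤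
        (j :: l).length * (8 * (j :: l).length + 2) + 1 := by
      rw [List.length_cons]
      nlinarith
    refine ih.bind_local fun r hr => ?_
    have := hr.1.length_eq
    exact (eddInsert_spec I j hr.2).mono fun s hs => ⟨hs.1.trans (hr.1.cons j), hs.2⟩

theorem longestAux_spec {S : List (Fin n)} {b : Fin n} {κ : ℕ} (h : I.IsLongest S b κ)
    (l : List (Fin n)) :
    Spec (longestAux I b κ (S.length + 1) l) (fun r => I.IsLongest (S ++ l) r.1 r.2)
      (4 * l.length + 1) 0 0 := by
  induction l generalizing S b κ with
  | nil => exact Spec.of_step (by simpa using h)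
  | cons a l ih =>
    have hS : S ++ a :: l = (S ++ [a]) ++ l := by simp
    have hlen : S.length + 1 + 1 = (S ++ [a]).length + 1 := by simp
    rw [List.length_cons, hS]
    refine Spec.step_bind (Spec.step_bind (Spec.step_bind (Spec.step_bind ?_)))
    rw [hlen]
    simp only [decide_eq_true_eq]
    obtain ⟨u, v, rfl, rfl, hu, hv⟩ := h
    split_ifs with hab
    · refine (ih ⟨u ++ b :: v, [], rfl, rfl, fun j hj => ?_, by simp⟩).mono fun _ => id
      grind
    · refine (ih ⟨u, v ++ [a], by simp, rfl, hu, fun j hj => ?_⟩).mono fun _ => id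
      grind

theorem longest_spec (a : Fin n) (l : List (Fin n)) :
    Spec (longest I a l) (fun r => I.IsLongest (a :: l) r.1 r.2) (4 * l.length + 1) 0 0 :=
  longestAux_spec I (S := [a]) ⟨[], [], rfl, rfl, by simp, by simp⟩ l

theorem someLate_spec (c : ℕ) (l : List (Fin n)) :
    Spec (someLate I c l) (fun b => b = true ↔ ∃ r ∈ l, c < I.d r + I.p r)
      (5 * l.length + 1) 0 0 := by
  induction l with
  | nil => exact Spec.of_step (by simp)
  | cons r l ih =>
    rw [List.length_cons]
    refine Spec.step_bind (Spec.step_bind (Spec.step_bind (Spec.step_bind ?_)))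
    simp only [decide_eq_true_eq]
    split_ifs with hr
    · exact Spec.of_step (by simp [hr])
    · exact ih.mono (by simp [hr])

theorem eliminated_spec (t : ℕ) (S : List (Fin n)) (κ i : ℕ) :
    Spec (eliminated I κ (t + I.load (S.take i)) (S.take i) (S.drop i))
      (fun b => b = true ↔ I.Eliminated t S κ i) (7 * S.length + 5) 0 0 := by
  have := (List.take_sublist i S).length_le
  have := (List.drop_sublist κ (S.take i)).length_le
  unfold Data.Eliminated
  refine (split_spec κ (S.take i)).bind_eq ((someLate_spec I _ _).bind_local fun b hb => ?_)
  cases S.drop i with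
  | nil => exact Spec.of_step (by simp [hb])
  | cons a A =>
    refine Spec.step_bind (Spec.step_bind ?_)
    simp only [decide_eq_true_eq]
    split_ifs with ha
    · exact Spec.of_step (by simp [ha])
    · exact Spec.of_step (by simp [ha, hb])

end Jobs

/-! ### TTBR1 -/

section Ttbr1

variable (I : Data n)

/-- A bound on the cost of TTBR1 with the given recursion depth. -/
def ttbr1Cost : ℕ → ℕ
  | 0 => 1
  | depth + 1 => (depth + 1) * (2 * ttbr1Cost depth + 19 * (depth + 1) + 12) + 5 * (depth + 1) + 5

/-- The body of the loop of TTBR1 for the jobs `S` with longest job `ℓ`, where position `i` is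
tried. -/
def ttbr1Branch (depth : ℕ) (S : List (Fin n)) (t : ℕ) (ℓ : Fin n) (i : ℕ)
    (seqOpt : List (Fin n)) : Comp (List (Fin n)) := do
  let (front, A) ← split i S
  let B ← remove ℓ front
  let c ← endTime I t front
  let left ← call (ttbr1 I depth B t)
  let right ← call (ttbr1 I depth A c)
  let tail ← cons ℓ right
  let seqCurrent ← append left tail
  best I t seqOpt seqCurrent

variable {I} {depth t κ i : ℕ} {S σ : List (Fin n)} {ℓ : Fin n}

theorem ttbr1Branch_spec (h : I.IsLongest S ℓ κ) (hκ : κ ≤ i) (hi : i ≤ S.length)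
    (hleft : Spec (ttbr1 I depth ((S.take i).erase ℓ) t) (I.Solves t ((S.take i).erase ℓ))
      (ttbr1Cost depth) 0 0)
    (hright : Spec (ttbr1 I depth (S.drop i) (t + I.load (S.take i)))
      (I.Solves (t + I.load (S.take i)) (S.drop i)) (ttbr1Cost depth) 0 0) (hσ : σ.Perm S) :
    Spec (ttbr1Branch I depth S t ℓ i σ) (fun r => r.Perm S ∧
      I.tardiness t r ≤ I.tardiness t σ ∧ I.DominatesPosition t r [] S ℓ i)
      (2 * ttbr1Cost depth + 19 * S.length + 11) 0 0 := by
  have htake := (List.take_sublist i S).length_le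
  have hdrop := (List.drop_sublist i S).length_le
  have herase := h.length_erase_take hκ hi
  refine (split_spec i S).bind_eq ((remove_spec ℓ _).bind_eq ((endTime_spec I t _).bind_eq ?_))
  refine (hleft.call_local fun β hβ => hβ.perm.length_eq.le).bind_local fun β hβ => ?_
  refine (hright.call_local fun α hα => hα.perm.length_eq.le).bind_local fun α hα => ?_
  have := hβ.perm.length_eq
  refine Spec.step_bind ((append_spec _ _).bind_eq ?_)
  have hdom := h.dominatesPosition_of_solves (π := []) (t := t) hκ (by simpa using hβ)
    (by simpa using hα)
  exact (best_spec I t hσ (h.perm_append_cons hκ hβ.perm hα.perm)).mono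
    fun r hr => ⟨hr.1, hr.2.1, hdom.of_le hr.2.2⟩

theorem ttbr1Branch_forLoop_spec (hS : I.IsEddSet S) (h : I.IsLongest S ℓ κ)
    (hrec : ∀ {S' : List (Fin n)}, I.IsEddSet S' → S'.length < S.length → ∀ t,
      Spec (ttbr1 I depth S' t) (I.Solves t S') (ttbr1Cost depth) 0 0) :
    Spec (forLoop (ttbr1Branch I depth S t ℓ) κ (S.length + 1 - κ) S) (I.Solves t S)
      (S.length * (2 * ttbr1Cost depth + 19 * S.length + 12) + 1) 0 0 := by
  have hκ := h.le_length
  have hpos := h.pos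
  refine (forLoop_spec (W := 2 * ttbr1Cost depth + 19 * S.length + 11) (X := fun _ => 0) (P := 0)
    (Inv := fun i σ => σ.Perm S ∧ ∀ j, κ ≤ j → j < i → I.DominatesPosition t σ [] S ℓ j)
    _ κ S ⟨.refl _, by omega⟩ fun i σ hi hi' hσ => ?_).mono (fun σ hσ => ⟨hσ.1, ?_⟩) ?_ (by simp)
  · refine (ttbr1Branch_spec h hi (by omega) (hrec (hS.erase_take i ℓ) ?_ _)
      (hrec (hS.drop i) ?_ _) hσ.1).mono fun r hr => ⟨hr.1, fun j hj hj' => ?_⟩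
    · rw [h.length_erase_take hi (by omega)]
      omega
    · rw [List.length_drop]
      omega
    · obtain hji | rfl := Nat.lt_succ_iff_lt_or_eq.1 hj'
      exacts [(hσ.2 j hj hji).of_le hr.2.1, hr.2.2]
  · exact h.dominates hS (π := []) fun i hi hi' _ => hσ.2 i hi (by omega)
  · gcongr
    omega

theorem ttbr1_spec (hS : I.IsEddSet S) (hdepth : S.length ≤ depth) (t : ℕ) :
    Spec (ttbr1 I depth S t) (I.Solves t S) (ttbr1Cost depth) 0 0 := by
  have hnil (t : ℕ) : I.Solves t [] [] := ⟨.refl _, fun τ hτ => by simp [hτ.eq_nil]⟩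
  induction depth generalizing S t with
  | zero =>
    obtain rfl := List.length_eq_zero_iff.1 (Nat.le_zero.1 hdepth)
    exact Spec.of_step (hnil t) le_rfl
  | succ depth ih =>
    rcases S with _ | ⟨a, l⟩
    · exact Spec.of_step (hnil t) (by simp [ttbr1Cost])
    have hlen : (a :: l).length = l.length + 1 := rfl
    have hcost : (a :: l).length * (2 * ttbr1Cost depth + 19 * (a :: l).length + 12) +
        5 * (a :: l).length + 5 ≤ ttbr1Cost (depth + 1) := by
      rw [ttbr1Cost]
      gcongr
    refine (longest_spec I a l).bind_local fun ⟨ℓ, κ⟩ hℓ =>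
      (length_spec _).bind_eq (Spec.step_bind (Spec.step_bind ?_))
    exact (ttbr1Branch_forLoop_spec hS hℓ fun hS' hlt t =>
      ih hS' (by omega) t).mono fun _ => id

end Ttbr1

/-! ### Children of a node and their merging -/

section Children

/-- `c` can serve as the `j`-th child of the node `(π, S)`: it fixes the right jobs, and if
position `j` of the longest job is eligible, then it is at least as good as every sequence that
puts the longest job there. -/
structure Branches (I : Data n) (t : ℕ) (π S : List (Fin n)) (j : ℕ)
    (c : Option (List (Fin n))) : Prop where
  perm : ∀ ρ ∈ c, ρ.Perm (π ++ S.take j)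
  le : ∀ ℓ κ, I.IsLongest S ℓ κ → κ ≤ j → ∃ ρ ∈ c, ∀ β, β.Perm ((S.take j).erase ℓ) →
    I.tardiness t ρ ≤ I.tardiness t (π ++ (β ++ [ℓ]))

/-- The entries of `C` can serve as the children `j, j + 1, …` of the node `(π, S)`. -/
def AreChildren (I : Data n) (t : ℕ) (π S : List (Fin n)) (j : ℕ)
    (C : List (Option (List (Fin n)))) : Prop :=
  ∀ c i, (c, i) ∈ C.zipIdx j → Branches I t π S i c

/-- `σ` is at least as good as every completion of the entries of `C`, which are the children
`j, j + 1, …` of a node with remaining jobs `S`. -/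
def DominatesChildren (I : Data n) (t : ℕ) (σ S : List (Fin n)) (j : ℕ)
    (C : List (Option (List (Fin n)))) : Prop :=
  ∀ ρ i, (some ρ, i) ∈ C.zipIdx j → I.Dominates t σ ρ (S.drop i)

variable {I : Data n} {k t i j : ℕ} {π S ρ σ τ J β : List (Fin n)} {ℓ : Fin n} {κ : ℕ}
  {c x y z : Option (List (Fin n))} {C L X Y : List (Option (List (Fin n)))}

@[simp] theorem areChildren_nil : AreChildren I t π S j [] := by
  simp [AreChildren]

@[simp] theorem areChildren_cons :
    AreChildren I t π S j (c :: C) ↔ Branches I t π S j c ∧ AreChildren I t π S (j + 1) C := by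
  simp only [AreChildren, List.zipIdx_cons, List.mem_cons, Prod.mk.injEq]
  grind

@[simp] theorem areChildren_append : AreChildren I t π S j (C ++ L) ↔
    AreChildren I t π S j C ∧ AreChildren I t π S (j + C.length) L := by
  simp only [AreChildren, List.zipIdx_append, List.mem_append]
  grind

@[simp] theorem dominatesChildren_nil : DominatesChildren I t σ S j [] := by
  simp [DominatesChildren]

@[simp] theorem dominatesChildren_cons : DominatesChildren I t σ S j (c :: C) ↔
    (∀ ρ ∈ c, I.Dominates t σ ρ (S.drop j)) ∧ DominatesChildren I t σ S (j + 1) C := by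
  simp only [DominatesChildren, List.zipIdx_cons, List.mem_cons, Prod.mk.injEq, Option.mem_def]
  grind

theorem DominatesChildren.of_append (h : DominatesChildren I t σ S j (C ++ L)) :
    DominatesChildren I t σ S j C :=
  fun ρ i hρ => h ρ i (by rw [List.zipIdx_append]; exact List.mem_append_left _ hρ)

theorem DominatesChildren.of_le (h : DominatesChildren I t σ S j C)
    (hle : I.tardiness t τ ≤ I.tardiness t σ) : DominatesChildren I t τ S j C :=
  fun ρ i hρ => (h ρ i hρ).of_le hle

theorem Branches.of_solves (h : I.IsLongest S ℓ κ) (hκ : κ ≤ j)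
    (hβ : I.Solves (t + I.load π) ((S.take j).erase ℓ) β) :
    Branches I t π S j (some (π ++ (β ++ [ℓ]))) := by
  refine ⟨?_, fun ℓ' κ' h' _ => ⟨_, rfl, fun β' hβ' => ?_⟩⟩
  · rintro ρ ⟨⟩
    exact (h.perm_take hκ hβ.perm).append_left π
  · obtain ⟨rfl, rfl⟩ := h.unique h'
    have hload := Data.load_eq_of_perm (I := I) (hβ.perm.trans hβ'.symm)
    simp only [Data.tardiness_append, hload]
    gcongr
    exact hβ.le β' hβ'

theorem AreChildren.dominatesPosition (hC : AreChildren I t π S 1 C)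
    (hσ : DominatesChildren I t σ S 1 C) (h : I.IsLongest S ℓ κ) (hκ : κ ≤ i)
    (hi : i ≤ C.length) : I.DominatesPosition t σ π S ℓ i := by
  have hpos := h.pos
  have hmem : (C[i - 1], i) ∈ C.zipIdx 1 := by
    rw [List.mk_mem_zipIdx_iff_le_and_getElem?_sub]
    exact ⟨by omega, List.getElem?_eq_getElem (by omega)⟩
  have hbranch := hC _ _ hmem
  obtain ⟨ρ, hρ, hle⟩ := hbranch.le ℓ κ h hκ
  exact h.dominatesPosition_of_dominates hκ (hbranch.perm ρ hρ) hle
    (hσ ρ i (Option.mem_def.1 hρ ▸ hmem))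

/-- A bound on the cost of computing a child by branching. -/
def childCost (n k : ℕ) : ℕ := 10 * n + 10 + ttbr1Cost k

theorem child_spec (hS : I.IsEddSet S) (hlen : π.length + S.length ≤ n) (hj : j ≤ k) (t : ℕ) :
    Spec (child I k t π S j) (Branches I t π S j) (childCost n k) 0 0 := by
  rw [childCost]
  rcases S with _ | ⟨a, l⟩
  · refine Spec.of_step ⟨by simp, fun ℓ κ h _ => ?_⟩
    exact absurd h.le_length h.pos.not_ge
  have hal : (a :: l).length = l.length + 1 := rfl
  refine (longest_spec I a l).bind_local fun ⟨ℓ, κ⟩ hℓ => Spec.step_bind ?_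
  simp only [decide_eq_true_eq]
  split_ifs with hκ
  · have htake := List.length_take_le j (a :: l)
    have htake' := (List.take_sublist j (a :: l)).length_le
    have herase : (((a :: l).take j).erase ℓ).length ≤ ((a :: l).take j).length :=
      List.length_erase_le
    refine (split_spec j _).bind_eq ((remove_spec ℓ ((a :: l).take j)).bind_eq
      ((endTime_spec I t π).bind_eq ?_))
    refine ((ttbr1_spec (hS.erase_take j ℓ) (by omega) _).call_local
      fun β hβ => hβ.perm.length_eq.le).bind_local fun β hβ => Spec.step_bind ?_
    have := hβ.perm.length_eq
    exact (append_spec β [ℓ]).bind_eq ((append_spec π _).bind_eq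
      (Spec.of_step (Branches.of_solves hℓ hκ hβ)))
  · refine Spec.of_step ⟨by simp, fun ℓ' κ' h hκ' => ?_⟩
    obtain ⟨rfl, rfl⟩ := hℓ.unique h
    exact absurd hκ' hκ

theorem childrenFrom_spec (hS : I.IsEddSet S) (hlen : π.length + S.length ≤ n) (t j m : ℕ)
    (hjm : j + m ≤ k + 1) :
    Spec (childrenFrom I k t π S j m) (fun C => C.length = m ∧ AreChildren I t π S j C)
      (m * (childCost n k + 2) + 1) 0 0 := by
  induction m generalizing j with
  | zero => exact Spec.of_step (by simp)
  | succ m ih =>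
    rw [Nat.succ_mul]
    refine (child_spec hS hlen (by omega) t).bind_local fun c hc => Spec.step_bind ?_
    refine (ih (j + 1) (by omega)).bind_local fun C hC => ?_
    exact Spec.of_step (by simp [hc, hC])

/-- The list of a node: it is empty or provides the first `k - 1` children. -/
structure IsChildList (I : Data n) (k t : ℕ) (π S : List (Fin n))
    (L : List (Option (List (Fin n)))) : Prop where
  length : L = [] ∨ L.length + 1 = k
  areChildren : AreChildren I t π S 1 L

theorem IsChildList.nil : IsChildList I k t π S [] := ⟨.inl rfl, areChildren_nil⟩

theorem firstChildren_spec (hS : I.IsEddSet S) (hlen : π.length + S.length ≤ n)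
    (hL : IsChildList I k t π S L) :
    Spec (firstChildren I k t π S L)
      (fun C => C.length = k ∧ AreChildren I t π S 1 C ∧ L <+: C)
      (k * (childCost n k + 3) + 3) 0 0 := by
  rcases L with _ | ⟨c, L⟩
  · refine (childrenFrom_spec hS hlen t 1 k (by omega)).mono
      (fun C hC => ⟨hC.1, hC.2, List.nil_prefix⟩) ?_
    gcongr <;> omega
  · have hk : (c :: L).length + 1 = k := hL.length.resolve_left (List.cons_ne_nil c L)
    have hcost : 1 * (childCost n k + 3) + (c :: L).length * 1 ≤ k * (childCost n k + 3) := by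
      rw [← hk]; nlinarith
    refine (childrenFrom_spec hS hlen t k 1 le_rfl).bind_local fun C hC => ?_
    refine (append_spec _ C).mono ?_
    rintro _ rfl
    refine ⟨by rw [List.length_append, hC.1, hk], areChildren_append.2 ⟨hL.areChildren, ?_⟩, ?_⟩
    · rw [add_comm 1, hk]; exact hC.2
    · exact List.prefix_append _ _

theorem bestNode_spec (t : ℕ) (hx : ∀ ρ ∈ x, ρ.Perm J) (hy : ∀ ρ ∈ y, ρ.Perm J) :
    Spec (bestNode I t x y) (fun z => (∀ ρ ∈ z, ρ.Perm J) ∧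
      (∀ ρ ∈ x, ∃ r ∈ z, I.tardiness t r ≤ I.tardiness t ρ) ∧
      ∀ ρ ∈ y, ∃ r ∈ z, I.tardiness t r ≤ I.tardiness t ρ) (10 * J.length + 5) 0 0 := by
  rcases x with _ | σ
  · exact Spec.of_step ⟨hy, by simp, fun ρ hρ => ⟨ρ, hρ, le_rfl⟩⟩
  rcases y with _ | τ
  · exact Spec.of_step ⟨hx, fun ρ hρ => ⟨ρ, hρ, le_rfl⟩, by simp⟩
  · exact (best_spec I t (hx σ rfl) (hy τ rfl)).bind_local
      fun r hr => Spec.of_step (by simpa using hr)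

theorem Branches.of_merge (hy : Branches I t π S j y)
    (hz : ∀ ρ ∈ z, ρ.Perm (π ++ S.take j))
    (hyz : ∀ ρ ∈ y, ∃ r ∈ z, I.tardiness t r ≤ I.tardiness t ρ) : Branches I t π S j z := by
  refine ⟨hz, fun ℓ κ h hκ => ?_⟩
  obtain ⟨ρ, hρ, hle⟩ := hy.le ℓ κ h hκ
  obtain ⟨r, hr, hrρ⟩ := hyz ρ hρ
  exact ⟨r, hr, fun β hβ => hrρ.trans (hle β hβ)⟩

theorem mergeNodes_spec {π₁ : List (Fin n)} (hπ₁ : π₁.Perm (π ++ S.take 1))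
    (hlen : π.length + S.length ≤ n) (hXY : X.length = Y.length)
    (hX : AreChildren I t π S (j + 1) X) (hY : AreChildren I t π₁ (S.drop 1) j Y) :
    Spec (mergeNodes I t X Y) (fun Z => Z.length = X.length ∧
      AreChildren I t π₁ (S.drop 1) j Z ∧ ∀ σ, DominatesChildren I t σ (S.drop 1) j Z →
        DominatesChildren I t σ S (j + 1) X) (X.length * (10 * n + 6) + 1) 0 0 := by
  induction X generalizing Y j with
  | nil => exact Spec.of_step (by simp)
  | cons x X ih =>
    obtain ⟨y, Y, rfl⟩ := List.exists_cons_of_length_eq_add_one hXY.symm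
    rw [areChildren_cons] at hX hY
    have hperm : (π ++ S.take (j + 1)).Perm (π₁ ++ (S.drop 1).take j) := by
      rw [add_comm j, List.take_add, ← List.append_assoc]
      exact hπ₁.symm.append_right _
    have hx : ∀ ρ ∈ x, ρ.Perm (π₁ ++ (S.drop 1).take j) := fun ρ hρ =>
      (hX.1.perm ρ hρ).trans hperm
    have hJ : (π₁ ++ (S.drop 1).take j).length ≤ n := by
      rw [← hperm.length_eq, List.length_append]
      have := (List.take_sublist (j + 1) S).length_le
      omega
    rw [List.length_cons, Nat.succ_mul]
    refine (bestNode_spec t hx hY.1.perm).bind_local fun z ⟨hz, hxz, hyz⟩ => ?_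
    refine (ih (by simpa using hXY) hX.2 hY.2).bind_local fun Z ⟨hlenZ, hZ, hdom⟩ => ?_
    refine Spec.of_step ⟨by simp [hlenZ], areChildren_cons.2 ⟨hY.1.of_merge hz hyz, hZ⟩,
      fun σ hσ => ?_⟩
    rw [dominatesChildren_cons] at hσ ⊢
    refine ⟨fun ρ hρ => ?_, hdom σ hσ.2⟩
    obtain ⟨r, hr, hrρ⟩ := hxz ρ hρ
    have hrdom := hσ.1 r hr
    rw [List.drop_drop, add_comm 1] at hrdom
    exact hrdom.of_perm_of_le ((hz r hr).trans (hx ρ hρ).symm) hrρ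

theorem leftMerge_spec {π₁ : List (Fin n)} (hS : I.IsEddSet S) (hlen : π.length + S.length ≤ n)
    (hpos : 0 < S.length) (hX : AreChildren I t π S 1 (some π₁ :: X)) (hk : X.length + 1 = k) :
    Spec (leftMerge I k t π₁ (S.drop 1) X) (fun L => IsChildList I k t π₁ (S.drop 1) L ∧
      ∀ σ, DominatesChildren I t σ (S.drop 1) 1 L → DominatesChildren I t σ S 2 X)
      (k * (childCost n k + 10 * n + 8) + 3) 0 0 := by
  rw [areChildren_cons] at hX
  have hπ₁ := hX.1.perm π₁ rfl
  have hlen₁ : π₁.length + (S.drop 1).length ≤ n := by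
    rw [hπ₁.length_eq, List.length_append, List.length_take, List.length_drop]
    omega
  have hcost : (k - 1) * (childCost n k + 2) + X.length * (10 * n + 6) ≤
      k * (childCost n k + 10 * n + 8) := by
    rw [show k - 1 = X.length by omega, ← hk]
    nlinarith
  refine Spec.step_bind ((childrenFrom_spec (hS.drop 1) hlen₁ t 1 (k - 1) (by omega)).bind_local
    fun Y hY => ?_)
  refine (mergeNodes_spec hπ₁ hlen (by omega) hX.2 hY.2).mono fun L hL => ?_
  exact ⟨⟨.inr (by omega), hL.2.1⟩, hL.2.2⟩

theorem explore_spec {solve : List (Fin n) → List (Fin n) → Comp (List (Fin n))} {W P : ℕ}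
    {T : ℕ → ℝ} (hsolve : ∀ ρ i, (some ρ, i) ∈ L.zipIdx j → Spec (call (solve ρ (S.drop i)))
      (fun r => r.Perm J ∧ I.Dominates t r ρ (S.drop i)) W (T i) P) (hT : ∀ i, 0 ≤ T i)
    (hσ : σ.Perm J) :
    Spec (explore I t solve S j L σ)
      (fun r => r.Perm J ∧ I.tardiness t r ≤ I.tardiness t σ ∧ DominatesChildren I t r S j L)
      (L.length * (2 * S.length + 10 * J.length + W + 6) + 1)
      (∑ i ∈ Finset.Ico j (j + L.length), T i) P := by
  induction L generalizing j σ with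
  | nil => exact Spec.of_step (by simpa using hσ) (hX := by simp)
  | cons c L ih =>
    have hsum := Finset.sum_eq_sum_Ico_succ_bot (show j < j + (L.length + 1) by omega) T
    have hT_j := hT j
    rw [List.length_cons, Nat.succ_mul]
    rw [show j + (L.length + 1) = j + 1 + L.length by omega] at hsum ⊢
    have ih (σ : List (Fin n)) (hσ : σ.Perm J) := ih (j := j + 1) (σ := σ)
      (fun ρ i hρ => hsolve ρ i (by simp [hρ])) hσ
    rcases c with _ | ρ
    · exact Spec.step_bind ((ih σ hσ).mono fun r hr => by simpa using hr)
    · refine (split_spec j S).bind_eq ((hsolve ρ j (by simp)).bind fun r hr => ?_)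
      refine (best_spec I t hσ hr.1).bind_local fun s hs => Spec.step_bind ?_
      refine (ih s hs.1).mono fun q hq => ⟨hq.1, hq.2.1.trans hs.2.1, ?_⟩
      simpa using ⟨hr.2.of_le (hq.2.1.trans hs.2.2), hq.2.2⟩

theorem completeSmall_spec (hS : I.IsEddSet S) (hk : S.length ≤ k) (t : ℕ) (π : List (Fin n)) :
    Spec (completeSmall I k t π S) (fun r => r.Perm (π ++ S) ∧ I.Dominates t r π S)
      (3 * π.length + S.length + ttbr1Cost k + 3) 0 0 := by
  refine (endTime_spec I t π).bind_eq (((ttbr1_spec hS hk _).call_local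
    fun σ hσ => hσ.perm.length_eq.le).bind_local fun σ hσ => ?_)
  refine (append_spec π σ).mono ?_
  rintro _ rfl
  refine ⟨hσ.perm.append_left π, fun τ hτ => ?_⟩
  rw [Data.tardiness_append, Data.tardiness_append]
  exact Nat.add_le_add_left (hσ.le τ hτ) _

end Children

/-! ### TTBM-L -/

section Ttbml

/-- `σ` is a sequence of the jobs of the node `(π, S)` with list `L`, and it is at least as good as
every completion of this node and of the nodes in `L`. -/
structure NodeSolution (I : Data n) (t : ℕ) (π S : List (Fin n)) (L : List (Option (List (Fin n))))
    (σ : List (Fin n)) : Prop where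
  perm : σ.Perm (π ++ S)
  dominates : I.Dominates t σ π S
  dominatesChildren : DominatesChildren I t σ S 1 L

/-- The recursive calls of TTBM-L on nodes with fewer than `m` remaining jobs are correct, take time
`O(n) + Y * x ^ |S|` for a node with remaining jobs `S`, and use at most `P` cells besides those of
the sequence that they return. -/
def SolvesNodes (I : Data n) (k depth m : ℕ) (x Y : ℝ) (P : ℕ) : Prop :=
  ∀ t π S L, I.IsEddSet S → π.length + S.length ≤ n → S.length < m → IsChildList I k t π S L →
    Spec (call (ttbmlNode I k depth t π S L)) (NodeSolution I t π S L) (1 + n)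
      (Y * x ^ S.length) P

/-- The part of TTBM-L on a node with remaining jobs `S` that treats its first children `C`. -/
def solveChildren (I : Data n) (k depth t : ℕ) (S seqInit : List (Fin n))
    (C : List (Option (List (Fin n)))) : Comp (List (Fin n)) :=
  match C with
  | some π₁ :: others => do
    let (_, S₁) ← split 1 S
    let L₁ ← leftMerge I k t π₁ S₁ others
    let seqCurrent ← call (ttbmlNode I k depth t π₁ S₁ L₁)
    best I t seqInit seqCurrent
  | others => explore I t (fun π' S' => ttbmlNode I k depth t π' S' []) S 1 others seqInit

/-- The body of the loop of TTBM-L on a node `(π, S)`, where position `i` of the longest job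
`ℓ = [κ]` is tried. -/
def ttbmlBranch (I : Data n) (k depth t t' κ : ℕ) (π S : List (Fin n)) (ℓ : Fin n) (i : ℕ)
    (seqOpt : List (Fin n)) : Comp (List (Fin n)) := do
  let eligible ← le κ i
  if eligible then do
    let (front, A) ← split i S
    let c ← endTime I t' front
    let e ← eliminated I κ c front A
    if e then step seqOpt else do
      let B ← remove ℓ front
      let left ← call (ttbmlNode I k depth t' [] B [])
      let right ← call (ttbmlNode I k depth c [] A [])
      let tail ← cons ℓ right
      let mid ← append left tail
      let seqCurrent ← append π mid
      best I t seqOpt seqCurrent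
  else step seqOpt

theorem ttbmlNode_succ_cons (I : Data n) (k depth t : ℕ) (π : List (Fin n)) (a : Fin n)
    (l : List (Fin n)) (L : List (Option (List (Fin n)))) :
    ttbmlNode I k (depth + 1) t π (a :: l) L = (do
      let m ← length (a :: l)
      let small ← lt m k
      if small then do
        let seqOpt ← completeSmall I k t π (a :: l)
        explore I t (completeSmall I k t) (a :: l) 1 L seqOpt
      else do
        let seqInit ← append π (a :: l)
        let children ← firstChildren I k t π (a :: l) L
        let seqOpt ← solveChildren I k depth t (a :: l) seqInit children
        let (ℓ, κ) ← longest I a l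
        let t' ← endTime I t π
        let first ← add k 1
        let count ← sub m k
        forLoop (ttbmlBranch I k depth t t' κ π (a :: l) ℓ) first count seqOpt) := by
  refine congrArg (_ >>= ·) (funext fun m => congrArg (_ >>= ·) (funext fun small => ?_))
  refine congrArg (ite _ _) (congrArg (_ >>= ·) (funext fun seqInit => ?_))
  refine congrArg (_ >>= ·) (funext fun C => ?_)
  rcases C with _ | ⟨_ | π₁, others⟩
  · rfl
  · rfl
  · simp only [solveChildren, Comp.bind_assoc]
    rfl

variable {I : Data n} {k depth t κ i P : ℕ} {x Y : ℝ} {π S σ ρ : List (Fin n)} {ℓ : Fin n}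
  {C L : List (Option (List (Fin n)))}

theorem NodeSolution.solves (h : NodeSolution I t [] S [] σ) : I.Solves t S σ :=
  ⟨h.perm, h.dominates⟩

theorem append_drop_perm (h : ρ.Perm (π ++ S.take i)) : (ρ ++ S.drop i).Perm (π ++ S) := by
  simpa using h.append_right (S.drop i)

theorem length_add_length_drop (h : ρ.Perm (π ++ S.take i)) :
    ρ.length + (S.drop i).length = π.length + S.length := by
  simpa only [List.length_append] using (append_drop_perm h).length_eq

theorem AreChildren.perm {j : ℕ} (hC : AreChildren I t π S j C) (hρ : (some ρ, i) ∈ C.zipIdx j) :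
    ρ.Perm (π ++ S.take i) :=
  (hC _ _ hρ).perm ρ rfl

theorem completeSmall_explore_spec (hS : I.IsEddSet S) (hlen : π.length + S.length ≤ n)
    (hk : S.length < k) (hL : IsChildList I k t π S L) :
    Spec (completeSmall I k t π S >>= explore I t (completeSmall I k t) S 1 L)
      (NodeSolution I t π S L)
      (k * (16 * n + ttbr1Cost k + 10) + 3 * n + ttbr1Cost k + 4) 0 0 := by
  have hJ : (π ++ S).length ≤ n := by simpa using hlen
  have hLk : L.length ≤ k := by
    rcases hL.length with rfl | h
    · exact Nat.zero_le k
    · omega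
  refine (completeSmall_spec hS hk.le t π).bind_local fun σ hσ => ?_
  have hsolve (ρ : List (Fin n)) (i : ℕ) (hρ : (some ρ, i) ∈ L.zipIdx 1) :
      Spec (call (completeSmall I k t ρ (S.drop i)))
        (fun r => r.Perm (π ++ S) ∧ I.Dominates t r ρ (S.drop i))
        (4 * n + ttbr1Cost k + 4) 0 0 := by
    have hperm := hL.areChildren.perm hρ
    have hlen' := length_add_length_drop hperm
    have hdrop := (List.drop_sublist i S).length_le
    refine ((completeSmall_spec (hS.drop i) (by omega) t ρ).call_local (N := n)
      fun r hr => ?_).mono fun r hr => ⟨hr.1.trans (append_drop_perm hperm), hr.2⟩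
    rw [hr.1.length_eq, List.length_append]
    omega
  refine (explore_spec hsolve (fun _ => le_rfl) hσ.1).mono
    (fun r hr => ⟨hr.1, hσ.2.of_le hr.2.1, hr.2.2⟩) ?_ (by simp)
  have hcost : L.length * (2 * S.length + 10 * (π ++ S).length + (4 * n + ttbr1Cost k + 4) + 6) ≤
      k * (16 * n + ttbr1Cost k + 10) :=
    Nat.mul_le_mul hLk (by omega)
  omega

theorem solveChildren_spec_of_none (hx : 2 ≤ x) (hY : 0 ≤ Y) (hS : I.IsEddSet S)
    (hlen : π.length + S.length ≤ n) (hcalls : SolvesNodes I k depth S.length x Y P)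
    (hC : AreChildren I t π S 1 (none :: C)) (hCS : C.length + 1 ≤ S.length) :
    Spec (solveChildren I k depth t S (π ++ S) (none :: C))
      (fun σ => σ.Perm (π ++ S) ∧ DominatesChildren I t σ S 1 (none :: C))
      (C.length * (13 * n + 7) + 2) (Y * x ^ (S.length - 1)) P := by
  have hJ : (π ++ S).length ≤ n := by simpa using hlen
  rw [areChildren_cons] at hC
  have hsolve (ρ : List (Fin n)) (i : ℕ) (hρ : (some ρ, i) ∈ C.zipIdx 2) :
      Spec (call (ttbmlNode I k depth t ρ (S.drop i) []))
        (fun r => r.Perm (π ++ S) ∧ I.Dominates t r ρ (S.drop i)) (1 + n)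
        (Y * x ^ (S.length - i)) P := by
    have hperm := hC.2.perm hρ
    have hi : 2 ≤ i := List.le_snd_of_mem_zipIdx hρ
    rw [← List.length_drop]
    refine (hcalls t ρ _ [] (hS.drop i) ?_ ?_ .nil).mono
      fun r hr => ⟨hr.perm.trans (append_drop_perm hperm), hr.dominates⟩
    · rwa [length_add_length_drop hperm]
    · rw [List.length_drop]
      omega
  refine Spec.step_bind ((explore_spec hsolve (fun i => by positivity) (.refl _)).mono
    (fun r hr => ⟨hr.1, by simpa using hr.2.2⟩) ?_ ?_)
  · have : C.length * (2 * S.length + 10 * (π ++ S).length + (1 + n) + 6) ≤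
        C.length * (13 * n + 7) :=
      Nat.mul_le_mul_left _ (by omega)
    omega
  · rw [← Finset.mul_sum]
    gcongr
    refine (sum_Ico_pow_sub_le (by linarith) 2 (by omega)).trans ?_
    exact div_le_self (by positivity) (by linarith)

theorem solveChildren_spec_of_some {π₁ : List (Fin n)} (hS : I.IsEddSet S)
    (hlen : π.length + S.length ≤ n) (hcalls : SolvesNodes I k depth S.length x Y P)
    (hC : AreChildren I t π S 1 (some π₁ :: C)) (hk : C.length + 1 = k) (hpos : 0 < S.length) :
    Spec (solveChildren I k depth t S (π ++ S) (some π₁ :: C))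
      (fun σ => σ.Perm (π ++ S) ∧ DominatesChildren I t σ S 1 (some π₁ :: C))
      (k * (childCost n k + 10 * n + 8) + 13 * n + 9) (Y * x ^ (S.length - 1)) P := by
  have hJ : (π ++ S).length ≤ n := by simpa using hlen
  have hπ₁ := hC.perm (ρ := π₁) (i := 1) (by simp)
  refine (split_spec 1 S).bind_eq ((leftMerge_spec hS hlen hpos hC hk).bind_local fun L hL => ?_)
  have hcall := hcalls t π₁ (S.drop 1) L (hS.drop 1) (by rwa [length_add_length_drop hπ₁])
    (by rw [List.length_drop]; omega) hL.1
  rw [List.length_drop] at hcall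
  refine hcall.bind fun σ hσ => (best_spec I t (.refl _)
    (hσ.perm.trans (append_drop_perm hπ₁))).mono fun r hr => ⟨hr.1, ?_⟩
  rw [dominatesChildren_cons]
  refine ⟨?_, (hL.2 σ hσ.dominatesChildren).of_le hr.2.2⟩
  rintro ρ ⟨⟩
  exact hσ.dominates.of_le hr.2.2

theorem solveChildren_spec (hx : 2 ≤ x) (hY : 0 ≤ Y) (hS : I.IsEddSet S)
    (hlen : π.length + S.length ≤ n) (hcalls : SolvesNodes I k depth S.length x Y P)
    (hC : AreChildren I t π S 1 C) (hCk : C.length = k) (hk : 0 < k) (hkS : k ≤ S.length) :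
    Spec (solveChildren I k depth t S (π ++ S) C)
      (fun σ => σ.Perm (π ++ S) ∧ DominatesChildren I t σ S 1 C)
      (k * (childCost n k + 13 * n + 8) + 13 * n + 9) (Y * x ^ (S.length - 1)) P := by
  rcases C with _ | ⟨_ | π₁, C⟩
  · exact absurd hCk.symm hk.ne'
  · refine (solveChildren_spec_of_none hx hY hS hlen hcalls hC (hCk.trans_le hkS)).mono
      (fun _ => id) ?_
    have hcost : C.length * (13 * n + 7) ≤ k * (childCost n k + 13 * n + 8) :=
      Nat.mul_le_mul ((Nat.le_succ _).trans hCk.le) (by omega)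
    omega
  · refine (solveChildren_spec_of_some hS hlen hcalls hC hCk (by omega)).mono (fun _ => id) ?_
    gcongr
    omega

theorem SolvesNodes.spec {m : ℕ} (h : SolvesNodes I k depth m x Y P) (hS : I.IsEddSet S)
    (hn : S.length ≤ n) (hm : S.length < m) :
    Spec (call (ttbmlNode I k depth t [] S [])) (I.Solves t S) (1 + n) (Y * x ^ S.length) P :=
  (h t [] S [] hS (by simpa using hn) hm .nil).mono fun _ => NodeSolution.solves

open Classical in
theorem ttbmlBranch_spec (h : I.IsLongest S ℓ κ) (hS : I.IsEddSet S)
    (hlen : π.length + S.length ≤ n) (hcalls : SolvesNodes I k depth S.length x Y P)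
    (hi : i ≤ S.length) (hσ : σ.Perm (π ++ S)) :
    Spec (ttbmlBranch I k depth t (t + I.load π) κ π S ℓ i σ)
      (fun r => r.Perm (π ++ S) ∧ I.tardiness t r ≤ I.tardiness t σ ∧
        (κ ≤ i → ¬ I.Eliminated (t + I.load π) S κ i → I.DominatesPosition t r π S ℓ i))
      (27 * n + 18)
      (if κ ≤ i ∧ ¬ I.Eliminated (t + I.load π) S κ i then
        Y * (x ^ (i - 1) + x ^ (S.length - i)) else 0) P := by
  have hJ : (π ++ S).length ≤ n := by simpa using hlen
  have htake := (List.take_sublist i S).length_le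
  have hpos := h.pos
  refine Spec.step_bind ?_
  by_cases hκ : κ ≤ i
  swap
  · simp only [hκ, decide_false, Bool.false_eq_true, if_false, false_and]
    exact Spec.of_step ⟨hσ, le_rfl, False.elim⟩
  simp only [hκ, decide_true, if_true, true_and, true_imp_iff]
  refine (split_spec i S).bind_eq ((endTime_spec I _ (S.take i)).bind_eq
    ((eliminated_spec I _ S κ i).bind_local fun e he => ?_))
  by_cases helim : I.Eliminated (t + I.load π) S κ i
  · simp only [he.2 helim, helim, not_true, if_true, if_false]
    exact Spec.of_step ⟨hσ, le_rfl, False.elim⟩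
  simp only [mt he.1 helim, helim, not_false_iff, if_true, Bool.false_eq_true, if_false,
    true_imp_iff]
  have herase := h.length_erase_take hκ hi
  have hleft := hcalls.spec (t := t + I.load π) (hS.erase_take i ℓ) (by omega) (by omega)
  have hright := hcalls.spec (t := t + I.load π + I.load (S.take i)) (hS.drop i)
    (by rw [List.length_drop]; omega) (by rw [List.length_drop]; omega)
  rw [herase] at hleft
  rw [List.length_drop] at hright
  refine (remove_spec ℓ (S.take i)).bind_eq (hleft.bind fun β hβ => hright.bind fun α hα => ?_)
  have := hβ.perm.length_eq
  refine Spec.step_bind ((append_spec _ _).bind_eq ((append_spec _ _).bind_eq ?_))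
  have hdom := h.dominatesPosition_of_solves hκ hβ hα
  exact (best_spec I t hσ ((h.perm_append_cons hκ hβ.perm hα.perm).append_left π)).mono
    fun r hr => ⟨hr.1, hr.2.1, hdom.of_le hr.2.2⟩

open Classical in
theorem ttbmlBranch_forLoop_spec (h : I.IsLongest S ℓ κ) (hS : I.IsEddSet S)
    (hlen : π.length + S.length ≤ n) (hcalls : SolvesNodes I k depth S.length x Y P)
    (hk : k ≤ S.length) (hσ : σ.Perm (π ++ S)) :
    Spec (forLoop (ttbmlBranch I k depth t (t + I.load π) κ π S ℓ) (k + 1) (S.length - k) σ)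
      (fun r => r.Perm (π ++ S) ∧ I.tardiness t r ≤ I.tardiness t σ ∧
        ∀ i, κ ≤ i → k < i → i ≤ S.length → ¬ I.Eliminated (t + I.load π) S κ i →
          I.DominatesPosition t r π S ℓ i)
      (n * (27 * n + 19) + 1)
      (Y * ∑ i ∈ Finset.Ico (k + 1) (S.length + 1) with
        κ ≤ i ∧ ¬ I.Eliminated (t + I.load π) S κ i, (x ^ (i - 1) + x ^ (S.length - i))) P := by
  rw [Finset.mul_sum, Finset.sum_filter, show S.length + 1 = k + 1 + (S.length - k) by omega]
  refine (forLoop_spec (W := 27 * n + 18) (P := P) (Inv := fun i r => r.Perm (π ++ S) ∧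
    I.tardiness t r ≤ I.tardiness t σ ∧ ∀ j, κ ≤ j → k < j → j < i →
    ¬ I.Eliminated (t + I.load π) S κ j → I.DominatesPosition t r π S ℓ j)
    _ (k + 1) σ ⟨hσ, le_rfl, by omega⟩
    fun i r hi hi' hr => ?_).mono (fun r hr => ⟨hr.1, hr.2.1, fun i hi hki hiS => ?_⟩) ?_ le_rfl
  · refine (ttbmlBranch_spec h hS hlen hcalls (by omega) hr.1).mono (fun r' hr' =>
      ⟨hr'.1, hr'.2.1.trans hr.2.1, fun j hj hkj hji he => ?_⟩) le_rfl le_rfl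
    obtain hji | rfl := Nat.lt_succ_iff_lt_or_eq.1 hji
    exacts [(hr.2.2 j hj hkj hji he).of_le hr'.2.1, hr'.2.2 hj he]
  · exact hr.2.2 i hi hki (by omega)
  · gcongr
    omega

/-- A bound on the work of TTBM-L on one node, without its recursive calls. -/
def nodeCost (n k : ℕ) : ℕ :=
  n * (27 * n + 19) + k * (2 * childCost n k + 13 * n + 11) + childCost n k + 30 * n + 30

theorem SolvesNodes.of_spec {N m : ℕ} (hx : 1 ≤ x)
    (h : ∀ t π S L, I.IsEddSet S → π.length + S.length ≤ n → S.length < m →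
      IsChildList I k t π S L → Spec (ttbmlNode I k depth t π S L) (NodeSolution I t π S L) N
        (N * S.length * x ^ S.length) (N * S.length)) :
    SolvesNodes I k depth m x (N * m) (N * m) := by
  intro t π S L hS hlen hm hL
  have hsize : (S.length : ℝ) + 1 ≤ m := mod_cast hm
  have hpow : 1 ≤ x ^ S.length := one_le_pow₀ hx
  refine ((h t π S L hS hlen hm hL).call (N := n) fun σ hσ => ?_).mono (fun _ => id) le_rfl ?_ ?_
  · rwa [hσ.perm.length_eq, List.length_append]
  · calc (N : ℝ) + N * S.length * x ^ S.length
        ≤ N * x ^ S.length + N * S.length * x ^ S.length := by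
          gcongr
          exact le_mul_of_one_le_right N.cast_nonneg hpow
      _ = N * (S.length + 1) * x ^ S.length := by ring
      _ ≤ N * m * x ^ S.length := by gcongr
  · calc N + N * S.length = N * (S.length + 1) := by ring
      _ ≤ N * m := Nat.mul_le_mul_left N hm

theorem ttbmlNode_spec_of_small (hS : I.IsEddSet S) (hlen : π.length + S.length ≤ n)
    (hk : S.length < k) (hL : IsChildList I k t π S L) :
    Spec (ttbmlNode I k (depth + 1) t π S L) (NodeSolution I t π S L) (nodeCost n k) 0 0 := by
  have hcost : k * (16 * n + ttbr1Cost k + 10) ≤ k * (2 * childCost n k + 13 * n + 11) :=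
    Nat.mul_le_mul_left k (by rw [childCost]; omega)
  have hchild : ttbr1Cost k ≤ childCost n k := by rw [childCost]; omega
  unfold nodeCost
  refine (length_spec S).bind_eq (Spec.step_bind ?_)
  simp only [hk, decide_true, if_true]
  exact (completeSmall_explore_spec hS hlen hk hL).mono fun _ => id

theorem NodeSolution.of_dominatesPosition (h : I.IsLongest S ℓ κ) (hS : I.IsEddSet S)
    (hC : AreChildren I t π S 1 C) (hσC : DominatesChildren I t σ S 1 C) (hLC : L <+: C)
    (hperm : ρ.Perm (π ++ S)) (hle : I.tardiness t ρ ≤ I.tardiness t σ)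
    (hρ : ∀ i, κ ≤ i → C.length < i → i ≤ S.length → ¬ I.Eliminated (t + I.load π) S κ i →
      I.DominatesPosition t ρ π S ℓ i) : NodeSolution I t π S L ρ := by
  have hρC := hσC.of_le hle
  refine ⟨hperm, h.dominates hS fun i hκ hi he => ?_, ?_⟩
  · rcases le_or_gt i C.length with hiC | hiC
    exacts [hC.dominatesPosition hρC h hκ hiC, hρ i hκ hiC hi he]
  · obtain ⟨C', rfl⟩ := hLC
    exact hρC.of_append

theorem ttbmlNode_spec_of_solvesNodes (hk : 0 < k) (hx : IsGrowthRate k x) (hY : 0 ≤ Y)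
    (hS : I.IsEddSet S) (hlen : π.length + S.length ≤ n) (hkS : k ≤ S.length)
    (hL : IsChildList I k t π S L) (hcalls : SolvesNodes I k depth S.length x Y P) :
    Spec (ttbmlNode I k (depth + 1) t π S L) (NodeSolution I t π S L) (nodeCost n k)
      (Y * x ^ S.length) P := by
  classical
  have hcost : k * (2 * childCost n k + 13 * n + 11) =
      k * (childCost n k + 3) + k * (childCost n k + 13 * n + 8) := by ring
  unfold nodeCost
  rcases S with _ | ⟨a, l⟩
  · exact absurd hkS hk.not_ge
  have hal : (a :: l).length = l.length + 1 := rfl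
  rw [ttbmlNode_succ_cons]
  refine (length_spec _).bind_eq (Spec.step_bind ?_)
  simp only [hkS.not_gt, decide_false, Bool.false_eq_true, if_false]
  refine (append_spec π (a :: l)).bind_eq ((firstChildren_spec hS hlen hL).bind_local
    fun C ⟨hCk, hC, hLC⟩ => ?_)
  refine (solveChildren_spec hx.two_le hY hS hlen hcalls hC hCk hk hkS).bind
    fun σ ⟨hσ, hσC⟩ => ?_
  refine (longest_spec I a l).bind_local fun ⟨ℓ, κ⟩ hℓ => (endTime_spec I t π).bind_eq
    (Spec.step_bind (Spec.step_bind ?_))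
  refine (ttbmlBranch_forLoop_spec hℓ hS hlen hcalls hkS hσ).mono (fun ρ hρ =>
    .of_dominatesPosition hℓ hS hC hσC hLC hρ.1 hρ.2.1 (hCk ▸ fun i hκ => hρ.2.2 i hκ)) ?_ ?_
  · omega
  · rw [le_sub_iff_add_le', ← mul_add]
    gcongr
    exact hx.sum_le hk hkS _ fun i hi hE hE' =>
      (I.eliminated_or_eliminated_succ _ _ hE.1 hi).elim hE.2 hE'.2

theorem ttbmlNode_spec (hk : 0 < k) (hx : IsGrowthRate k x) (hS : I.IsEddSet S)
    (hlen : π.length + S.length ≤ n) (hdepth : S.length < depth)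
    (hL : IsChildList I k t π S L) :
    Spec (ttbmlNode I k depth t π S L) (NodeSolution I t π S L) (nodeCost n k)
      (nodeCost n k * S.length * x ^ S.length) (nodeCost n k * S.length) := by
  induction depth generalizing t π S L with
  | zero => exact absurd hdepth (Nat.not_lt_zero _)
  | succ depth ih =>
    have hx0 : 0 < x := zero_lt_one.trans hx.one_lt
    rcases lt_or_ge S.length k with hkS | hkS
    · exact (ttbmlNode_spec_of_small hS hlen hkS hL).mono (fun _ => id) le_rfl (by positivity)
    · exact ttbmlNode_spec_of_solvesNodes hk hx (by positivity) hS hlen hkS hL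
        (.of_spec hx.one_lt.le fun t π S' L hS' hlen' hlt hL' =>
          ih hS' hlen' (by omega) hL')

theorem ttbml_spec (I : Data n) (hk : 0 < k) (hx : IsGrowthRate k x) :
    Spec (ttbml I k) I.IsOptimal (n * (8 * n + 2) + 1 + nodeCost n k)
      (nodeCost n k * n * x ^ n) (nodeCost n k * n) := by
  have hsort := eddSort_spec I (List.finRange n)
  rw [List.length_finRange] at hsort
  refine hsort.bind_local fun S ⟨hperm, hedd⟩ => ?_
  have hlen : S.length = n := by rw [hperm.length_eq, List.length_finRange]
  have hnodup : S.Nodup := hperm.nodup_iff.2 (List.nodup_finRange n)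
  have hnode := ttbmlNode_spec (I := I) (t := 0) (π := []) (depth := n + 1) hk hx ⟨hedd, hnodup⟩
    (by simp [hlen]) (by omega) .nil
  rw [hlen] at hnode
  refine hnode.mono fun σ hσ => ?_
  have hσS : σ.Perm S := hσ.perm
  refine ⟨⟨hσS.nodup_iff.2 hnodup, fun j => (hσS.trans hperm).mem_iff.2 (List.mem_finRange j)⟩,
    fun τ hτ => hσ.dominates τ ((List.perm_ext_iff_of_nodup hτ.1 hnodup).2 fun j => ?_)⟩
  exact iff_of_true (hτ.2 j) (hperm.mem_iff.2 (List.mem_finRange j))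

/-- A polynomial in the number of jobs that bounds the space of TTBM-L and the polynomial factor of
its time. -/
noncomputable def ttbmlPolynomial (k : ℕ) : Polynomial ℕ :=
  let child := 10 * .X + 10 + .C (ttbr1Cost k)
  let node := .X * (27 * .X + 19) + .C k * (2 * child + 13 * .X + 11) + child + 30 * .X + 30
  .X * (8 * .X + 2) + 1 + node * (.X + 1)

theorem eval_ttbmlPolynomial (n k : ℕ) :
    (ttbmlPolynomial k).eval n = n * (8 * n + 2) + 1 + nodeCost n k * (n + 1) := by
  simp [ttbmlPolynomial, nodeCost, childCost]

theorem time_ttbml_le (I : Data n) (hk : 0 < k) (hx : IsGrowthRate k x) :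
    ((ttbml I k).time : ℝ) ≤ ((ttbmlPolynomial k).eval n : ℕ) * x ^ n := by
  have hpow : 1 ≤ x ^ n := one_le_pow₀ hx.one_lt.le
  calc ((ttbml I k).time : ℝ)
      ≤ (n * (8 * n + 2) + 1 + nodeCost n k : ℕ) + nodeCost n k * n * x ^ n :=
        (ttbml_spec I hk hx).time
    _ ≤ (n * (8 * n + 2) + 1 + nodeCost n k : ℕ) * x ^ n + nodeCost n k * n * x ^ n := by
        gcongr
        exact le_mul_of_one_le_right (Nat.cast_nonneg _) hpow
    _ = ((ttbmlPolynomial k).eval n : ℕ) * x ^ n := by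
        rw [eval_ttbmlPolynomial]
        push_cast
        ring

theorem peak_ttbml_le (I : Data n) (hk : 0 < k) :
    (ttbml I k).peak ≤ (ttbmlPolynomial k).eval n := by
  refine (ttbml_spec I hk (isGrowthRate_of_pos hk)).peak.trans_eq ?_
  rw [eval_ttbmlPolynomial]
  ring

end Ttbml

end TotalTardiness

theorem mainTheorem9 :
    (∀ k : ℕ, 2 ≤ k → ∀ (n : ℕ) (I : TotalTardiness.Data n),
      I.IsOptimal (TotalTardiness.ttbml I k).val) ∧
    ∃ ε : ℕ → ℝ, (∀ k, 0 ≤ ε k) ∧ Filter.Tendsto ε Filter.atTop (nhds 0) ∧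
      ∀ k : ℕ, 2 ≤ k → ∃ q : Polynomial ℕ, ∀ (n : ℕ) (I : TotalTardiness.Data n),
        ((TotalTardiness.ttbml I k).time : ℝ) ≤ ((q.eval n : ℕ) : ℝ) * (2.247 + ε k) ^ n ∧
        (TotalTardiness.ttbml I k).peak ≤ q.eval n := by
  have hpos {k : ℕ} (hk : 2 ≤ k) : 0 < k := two_pos.trans_le hk
  refine ⟨fun k hk n I =>
      (TotalTardiness.ttbml_spec I (hpos hk) (TotalTardiness.isGrowthRate_of_pos (hpos hk))).val,
    fun k => if 20 ≤ k then 0 else 1, fun k => by positivity, ?_, fun k hk =>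
    ⟨TotalTardiness.ttbmlPolynomial k, fun n I =>
      ⟨TotalTardiness.time_ttbml_le I (hpos hk) ?_, TotalTardiness.peak_ttbml_le I (hpos hk)⟩⟩⟩
  · refine tendsto_const_nhds.congr' ?_
    filter_upwards [Filter.eventually_ge_atTop 20] with k hk
    rw [if_pos hk]
  · beta_reduce
    split_ifs with h20
    · rw [add_zero]
      exact TotalTardiness.isGrowthRate_of_twenty_le h20
    · exact TotalTardiness.isGrowthRate_of_pos (hpos hk)
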